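/- Let $F$ be a subfield of $\mathbb R$ and $F_{\ge 0}$, $F_{>0}$ its sets of nonnegative and positive elements. Let $S=\{g_1,\dots,g_s\}\subset F[x]$ be a finite set and let $$K=K_S=\{t\in\mathbb R : g_i(t)\ge 0 \text{ for } i=1,\dots,s\}.$$ Assume that $K$ is not compact and that its boundary satisfies $\partial K\subset F$. Put $\mathrm{Pos}(K)=\{f\in F[x] : f\ge 0 \text{ on } K\}$. For a finite set $P\subset F[x]$ let $T_P$ (the preordering generated by $P$) be the set of all finite sums of terms $a\,q^2\prod_{g\in E}g$ with $a\in F_{\ge0}$, $q\in F[x]$, $E\subset P$, and let $M_P$ (the quadratic module generated by $P$) be the set of all finite sums of terms $a\,q^2 g$ with $a\in F_{\ge 0}$, $q\in F[x]$, $g\in P\cup\{1\}$. The natural choice of generators $\mathcal N\subset F[x]$ of $K$ is $\mathcal N=\{1\}$ if $K=\mathbb R$, and if $K\ne\mathbb R$ it consists of the following polynomials: $x-a$ for $a\in\partial K$ with $(-\infty,a)\cap K=\emptyset$; $a-x$ for $a\in\partial K$ with $(a,\infty)\cap K=\emptyset$; and $(x-a)(x-b)$ for $a,b\in\partial K$ with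 $a<b$ and $(a,b)\cap K=\emptyset$. Then: 1. $\mathrm{Pos}(K)=T_S$ (that is, $T_S$ is saturated) if and only if $S\cup\{1\}$ contains $\mathcal N$ up to scaling by $F_{>0}$, that is, for every $g\in\mathcal N$ there is $c\in F_{>0}$ with $cg\in S\cup\{1\}$. (For $K\neq\mathbb R$ the condition just says that $S$ contains $\mathcal N$ up to scaling by $F_{>0}$; for $K=\mathbb R$ it always holds.) 2. $\mathrm{Pos}(K)=M_{\mathcal N}$ (that is, $M_{\mathcal N}$ is saturated) if and only if either $|\mathcal N|\le 1$, or $|\mathcal N|=2$ and $K$ has an isolated point. -/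

import Mathlib

open Polynomial

namespace SaturationLine

/-- The basic closed set `K_S`: the real points at which all members of `S` are nonnegative. -/
def basicClosed {F : Subfield ℝ} (S : Set F[X]) : Set ℝ :=
  {x : ℝ | ∀ g ∈ S, 0 ≤ aeval x g}

/-- `Pos(K)`: the polynomials over `F` that are nonnegative on `K`. -/
def posOn (F : Subfield ℝ) (K : Set ℝ) : Set F[X] :=
  {f : F[X] | ∀ x ∈ K, 0 ≤ aeval x f}

/-- The preordering `T_S`: all finite sums of terms `a * q ^ 2 * g₁ * ⋯ * gₖ` with `a ≥ 0` in `F`,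
`q` in `F[x]` and `g₁, …, gₖ` distinct members of `S` (the empty product being `1`). -/
def preordering {F : Subfield ℝ} (S : Set F[X]) : Set F[X] :=
  (AddSubmonoid.closure
    {p : F[X] | ∃ (a : F) (q : F[X]) (t : Finset F[X]),
      (0 : ℝ) ≤ (a : ℝ) ∧ (t : Set F[X]) ⊆ S ∧ p = C a * q ^ 2 * ∏ g ∈ t, g} : Set F[X])

/-- The quadratic module `M_S`: all finite sums of terms `a * q ^ 2 * g` with `a ≥ 0` in `F`,
`q` in `F[x]` and `g` in `{1} ∪ S`. -/
def quadraticModule {F : Subfield ℝ} (S : Set F[X]) : Set F[X] :=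
  (AddSubmonoid.closure
    {p : F[X] | ∃ (a : F) (q g : F[X]),
      (0 : ℝ) ≤ (a : ℝ) ∧ g ∈ insert 1 S ∧ p = C a * q ^ 2 * g} : Set F[X])

/-- The natural choice of generators of a finite union `K` of closed intervals whose boundary
lies in `F`. When `K` is the whole line its boundary is empty and only the first part `{1}`
is left. -/
def naturalGenerators (F : Subfield ℝ) (K : Set ℝ) : Set F[X] :=
  {p : F[X] | K = Set.univ ∧ p = 1} ∪
  {p : F[X] | ∃ a : F, (a : ℝ) ∈ frontier K ∧ Set.Iio (a : ℝ) ∩ K = ∅ ∧ p = X - C a} ∪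
  {p : F[X] | ∃ a : F, (a : ℝ) ∈ frontier K ∧ Set.Ioi (a : ℝ) ∩ K = ∅ ∧ p = C a - X} ∪
  {p : F[X] | ∃ a b : F, (a : ℝ) ∈ frontier K ∧ (b : ℝ) ∈ frontier K ∧ (a : ℝ) < (b : ℝ) ∧
    Set.Ioo (a : ℝ) (b : ℝ) ∩ K = ∅ ∧ p = (X - C a) * (X - C b)}

/-- `S` contains every member of `N` up to scaling by positive elements of `F`. -/
def ContainsUpToScaling {F : Subfield ℝ} (S N : Set F[X]) : Prop :=
  ∀ g ∈ N, ∃ c : F, (0 : ℝ) < (c : ℝ) ∧ C c * g ∈ S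

/-- `K` has an isolated point. -/
def HasIsolatedPoint (K : Set ℝ) : Prop :=
  ∃ x : ℝ, ∃ U : Set ℝ, IsOpen U ∧ U ∩ K = {x}

end SaturationLine

/-!
# Saturated preorderings and quadratic modules on the line, over a subfield of `ℝ`

*Natural generators suffice for the preordering* (`posOn_subset`). Let `T` be a semiring of
polynomials over `F` that contains the nonnegative constants, the squares and the natural
generators. If `f` is nonnegative on `K` and splits over `F`, then its roots, listed with
multiplicity in decreasing order, group into pairs between which `f` is negative; such a pair lies
in the closure of one gap of `K`, where moving the ends of the gap inwards only adds squares, so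
`f ∈ T` (`prod_X_sub_C_mem`, `neg_prod_X_sub_C_mem`). In general write `f = u * g` with `u` split
over `F` and `g` without roots in `F`. If `g` has a zero in `K`, this zero is interior because
`∂K ⊆ F`, so `f` is divisible by the square of its minimal polynomial, and induction on the degree
applies. Otherwise every real polynomial `g'` close to `g`, of no larger degree, has the sign of
`g` on `K`. Its real roots lie off `K` and can be moved into `F` without crossing `K`, while its
positive part is a limit of sums of squares over `F`; hence `g'` is a limit of polynomials `h` over
`F` with `u * h ∈ T` (`exists_coeffTendsto_mul_mem`). A point of a vector space over `F` all of
whose real neighbours are limits of members of a convex cone lies in the cone itself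
(`mem_of_simplex_limit`), so `u * g ∈ T`.

*Necessity.* As `K` is unbounded, the degrees of summands that are nonnegative on `K` cannot cancel
(`natDegree_le_of_le_on_unbounded`). For the preordering, a summand of a natural generator `g` that
is negative in the gap of `g` is thus a scalar multiple of `g`, and so is one of its factors from
`S` (`containsUpToScaling_of_subset`). For the quadratic module, let `l` and `r` be generators of
two gaps without a common end. Then `l * r` is nonnegative on `K` and has as many distinct zeros in
`K` as its degree, at least three, whereas a nonzero summand `a * q ^ 2 * g` with those zeros has
larger degree (`notMem_quadraticModule`). Two such gaps exist unless there is at most one gap or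
there are two that meet in an isolated point (`exists_separated`). In these remaining cases the
quadratic module is closed under multiplication, because of an explicit formula for `l * r`
(`mul_mem_quadraticModule_of_isolated`), and the result on preorderings applies to it.
-/

namespace SaturationLine

/-! ### Gaps of `K`, and split polynomials -/

theorem isClosed_basicClosed {F : Subfield ℝ} (S : Set F[X]) : IsClosed (basicClosed S) := by
  have : basicClosed S = ⋂ g ∈ S, {x : ℝ | 0 ≤ aeval x g} := by
    ext x; simp [basicClosed]
  rw [this]
  exact isClosed_biInter fun g _ => isClosed_le continuous_const g.continuous_aeval

theorem mem_frontier_of_Ioo_left {K : Set ℝ} {a e : ℝ} (ha : a ∈ K) (he : e < a)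
    (h : Set.Ioo e a ∩ K = ∅) : a ∈ frontier K := by
  refine ⟨subset_closure ha, fun hi => ?_⟩
  have h1 : ∀ᶠ x in nhdsWithin a (Set.Iio a), x ∈ K :=
    nhdsWithin_le_nhds (mem_interior_iff_mem_nhds.1 hi)
  obtain ⟨x, hx, hx'⟩ := (h1.and (Ioo_mem_nhdsLT he)).exists
  exact Set.eq_empty_iff_forall_notMem.1 h x ⟨hx', hx⟩

theorem mem_frontier_of_Ioo_right {K : Set ℝ} {a e : ℝ} (ha : a ∈ K) (he : a < e)
    (h : Set.Ioo a e ∩ K = ∅) : a ∈ frontier K := by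
  refine ⟨subset_closure ha, fun hi => ?_⟩
  have h1 : ∀ᶠ x in nhdsWithin a (Set.Ioi a), x ∈ K :=
    nhdsWithin_le_nhds (mem_interior_iff_mem_nhds.1 hi)
  obtain ⟨x, hx, hx'⟩ := (h1.and (Ioo_mem_nhdsGT he)).exists
  exact Set.eq_empty_iff_forall_notMem.1 h x ⟨hx', hx⟩

section Generators

variable {F : Subfield ℝ} {K : Set ℝ}

theorem exists_left_generator (hcl : IsClosed K) (hbd : frontier K ⊆ (F : Set ℝ))
    (hne : K.Nonempty) (hb : BddBelow K) :
    ∃ a : F, IsLeast K (a : ℝ) ∧ X - C a ∈ naturalGenerators F K := by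
  have hl := hcl.isLeast_csInf hne hb
  have hI : Set.Iio (sInf K) ∩ K = ∅ :=
    Set.eq_empty_iff_forall_notMem.2 fun x hx => not_lt.2 (hl.2 hx.2) hx.1
  have hf : sInf K ∈ frontier K := mem_frontier_of_Ioo_left hl.1 (sub_one_lt _)
    (Set.eq_empty_iff_forall_notMem.2 fun x hx => not_lt.2 (hl.2 hx.2) hx.1.2)
  exact ⟨⟨sInf K, hbd hf⟩, hl, Or.inl (Or.inl (Or.inr ⟨_, hf, hI, rfl⟩))⟩

theorem exists_right_generator (hcl : IsClosed K) (hbd : frontier K ⊆ (F : Set ℝ))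
    (hne : K.Nonempty) (hb : BddAbove K) :
    ∃ a : F, IsGreatest K (a : ℝ) ∧ C a - X ∈ naturalGenerators F K := by
  have hl := hcl.isGreatest_csSup hne hb
  have hI : Set.Ioi (sSup K) ∩ K = ∅ :=
    Set.eq_empty_iff_forall_notMem.2 fun x hx => not_lt.2 (hl.2 hx.2) hx.1
  have hf : sSup K ∈ frontier K := mem_frontier_of_Ioo_right hl.1 (lt_add_one _)
    (Set.eq_empty_iff_forall_notMem.2 fun x hx => not_lt.2 (hl.2 hx.2) hx.1.1)
  exact ⟨⟨sSup K, hbd hf⟩, hl, Or.inl (Or.inr ⟨_, hf, hI, rfl⟩)⟩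

/-- An interval that avoids `K`, with points of `K` on both sides, lies in a bounded gap of `K`. -/
theorem exists_gap_generator (hcl : IsClosed K) (hbd : frontier K ⊆ (F : Set ℝ)) {c d : ℝ}
    (hcd : c < d) (h : Set.Ioo c d ∩ K = ∅) (hc : (K ∩ Set.Iic c).Nonempty)
    (hd : (K ∩ Set.Ici d).Nonempty) :
    ∃ a b : F, (a : ℝ) ≤ c ∧ d ≤ (b : ℝ) ∧ (a : ℝ) ∈ K ∧ (b : ℝ) ∈ K ∧
      Set.Ioo (a : ℝ) (b : ℝ) ∩ K = ∅ ∧ (X - C a) * (X - C b) ∈ naturalGenerators F K := by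
  have hg := (hcl.inter isClosed_Iic).isGreatest_csSup hc ⟨c, fun x hx => hx.2⟩
  have hl := (hcl.inter isClosed_Ici).isLeast_csInf hd ⟨d, fun x hx => hx.2⟩
  set a := sSup (K ∩ Set.Iic c)
  set b := sInf (K ∩ Set.Ici d)
  have hac : a ≤ c := hg.1.2
  have hdb : d ≤ b := hl.1.2
  have hab : a < b := by linarith
  have hI : Set.Ioo a b ∩ K = ∅ := by
    refine Set.eq_empty_iff_forall_notMem.2 fun x hx => ?_
    rcases le_or_gt x c with h1 | h1
    · exact not_lt.2 (hg.2 ⟨hx.2, h1⟩) hx.1.1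
    rcases le_or_gt d x with h2 | h2
    · exact not_lt.2 (hl.2 ⟨hx.2, h2⟩) hx.1.2
    exact Set.eq_empty_iff_forall_notMem.1 h x ⟨⟨h1, h2⟩, hx.2⟩
  have hfa := mem_frontier_of_Ioo_right hg.1.1 hab hI
  have hfb := mem_frontier_of_Ioo_left hl.1.1 hab hI
  exact ⟨⟨a, hbd hfa⟩, ⟨b, hbd hfb⟩, hac, hdb, hg.1.1, hl.1.1, hI,
    Or.inr ⟨_, _, hfa, hfb, hab, hI, rfl⟩⟩

end Generators

section Split

variable {F : Subfield ℝ} {K : Set ℝ} {T : Subsemiring F[X]}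

theorem X_sub_C_mem_of_forall_le (hcl : IsClosed K) (hbd : frontier K ⊆ (F : Set ℝ))
    (hne : K.Nonempty) (hC : ∀ a : F, (0 : ℝ) ≤ (a : ℝ) → C a ∈ T)
    (hN : naturalGenerators F K ⊆ T) {c : F} (h : ∀ x ∈ K, (c : ℝ) ≤ x) : X - C c ∈ T := by
  obtain ⟨a, ha, haN⟩ := exists_left_generator hcl hbd hne ⟨c, h⟩
  have : X - C c = (X - C a) + C (a - c) := by rw [C_sub]; ring
  rw [this]
  exact T.add_mem (hN haN) (hC _ (by push_cast; linarith [h _ ha.1]))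

theorem C_sub_X_mem_of_forall_le (hcl : IsClosed K) (hbd : frontier K ⊆ (F : Set ℝ))
    (hne : K.Nonempty) (hC : ∀ a : F, (0 : ℝ) ≤ (a : ℝ) → C a ∈ T)
    (hN : naturalGenerators F K ⊆ T) {c : F} (h : ∀ x ∈ K, x ≤ (c : ℝ)) : C c - X ∈ T := by
  obtain ⟨a, ha, haN⟩ := exists_right_generator hcl hbd hne ⟨c, h⟩
  have : C c - X = (C a - X) + C (c - a) := by rw [C_sub]; ring
  rw [this]
  exact T.add_mem (hN haN) (hC _ (by push_cast; linarith [h _ ha.1]))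

/-- Moving one root of a quadratic polynomial towards the other one adds a multiple of a square. -/
theorem X_sub_C_mul_X_sub_C_mem_of_between
    (hC : ∀ a : F, (0 : ℝ) ≤ (a : ℝ) → C a ∈ T) (hsq : ∀ q : F[X], q ^ 2 ∈ T) {a b d : F}
    (h1 : (a : ℝ) < b) (h2 : (a : ℝ) ≤ d) (h3 : (d : ℝ) ≤ b)
    (h : (X - C a) * (X - C b) ∈ T) :
    (X - C a) * (X - C d) ∈ T ∧ (X - C d) * (X - C b) ∈ T := by
  have hab : b - a ≠ 0 := by
    intro h0
    have := congrArg (fun z : F => (z : ℝ)) h0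
    push_cast at this
    linarith
  have h0 : (0 : ℝ) < b - a := by linarith
  set t : F := (d - a) / (b - a) with ht
  have hd : d = t * b + (1 - t) * a := by rw [ht]; field_simp; ring
  have ht0 : (0 : ℝ) ≤ t := by
    rw [ht]; push_cast; exact div_nonneg (by linarith) h0.le
  have ht1 : (0 : ℝ) ≤ ((1 - t : F) : ℝ) := by
    rw [ht]; push_cast; rw [sub_nonneg, div_le_one h0]; linarith
  constructor
  · have : (X - C a) * (X - C d) = C t * ((X - C a) * (X - C b)) + C (1 - t) * (X - C a) ^ 2 := by
      rw [hd]; simp only [C_add, C_mul, C_sub, C_1]; ring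
    rw [this]
    exact T.add_mem (T.mul_mem (hC _ ht0) h) (T.mul_mem (hC _ ht1) (hsq _))
  · have : (X - C d) * (X - C b) = C (1 - t) * ((X - C a) * (X - C b)) + C t * (X - C b) ^ 2 := by
      rw [hd]; simp only [C_add, C_mul, C_sub, C_1]; ring
    rw [this]
    exact T.add_mem (T.mul_mem (hC _ ht1) h) (T.mul_mem (hC _ ht0) (hsq _))

/-- A pair of points with no point of `K` between them lies in a closed gap of `K`, or on one side
of `K`. -/
theorem X_sub_C_mul_X_sub_C_mem (hcl : IsClosed K) (hbd : frontier K ⊆ (F : Set ℝ))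
    (hne : K.Nonempty) (hC : ∀ a : F, (0 : ℝ) ≤ (a : ℝ) → C a ∈ T) (hsq : ∀ q : F[X], q ^ 2 ∈ T)
    (hN : naturalGenerators F K ⊆ T) {c d : F} (hcd : (c : ℝ) ≤ d)
    (h : Set.Ioo (c : ℝ) d ∩ K = ∅) : (X - C c) * (X - C d) ∈ T := by
  rcases hcd.eq_or_lt with hcd | hcd
  · rw [Subtype.ext hcd, ← pow_two]; exact hsq _
  have h := Set.eq_empty_iff_forall_notMem.1 h
  rcases (K ∩ Set.Iic (c : ℝ)).eq_empty_or_nonempty with h1 | h1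
  · have h1 := Set.eq_empty_iff_forall_notMem.1 h1
    have hd : ∀ x ∈ K, (d : ℝ) ≤ x := fun x hx => by
      by_contra! hlt
      rcases le_or_gt x c with h2 | h2
      · exact h1 x ⟨hx, h2⟩
      · exact h x ⟨⟨h2, hlt⟩, hx⟩
    exact T.mul_mem
      (X_sub_C_mem_of_forall_le hcl hbd hne hC hN fun x hx => hcd.le.trans (hd x hx))
      (X_sub_C_mem_of_forall_le hcl hbd hne hC hN hd)
  rcases (K ∩ Set.Ici (d : ℝ)).eq_empty_or_nonempty with h2 | h2
  · have h2 := Set.eq_empty_iff_forall_notMem.1 h2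
    have hd : ∀ x ∈ K, x ≤ (c : ℝ) := fun x hx => by
      by_contra! hlt
      rcases le_or_gt (d : ℝ) x with h3 | h3
      · exact h2 x ⟨hx, h3⟩
      · exact h x ⟨⟨hlt, h3⟩, hx⟩
    have : (X - C c) * (X - C d) = (C c - X) * (C d - X) := by ring
    rw [this]
    exact T.mul_mem
      (C_sub_X_mem_of_forall_le hcl hbd hne hC hN hd)
      (C_sub_X_mem_of_forall_le hcl hbd hne hC hN fun x hx => (hd x hx).trans hcd.le)
  obtain ⟨a, b, hac, hdb, -, -, -, hab⟩ :=
    exists_gap_generator hcl hbd hcd (Set.eq_empty_iff_forall_notMem.2 h) h1 h2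
  have h3 := (X_sub_C_mul_X_sub_C_mem_of_between hC hsq (d := d) (by linarith) (by linarith) hdb
    (hN hab)).1
  exact (X_sub_C_mul_X_sub_C_mem_of_between hC hsq (by linarith) hac hcd.le h3).2

theorem prod_sub_nonneg {R : Multiset F} {x : ℝ} (h : ∀ r ∈ R, (r : ℝ) ≤ x) :
    0 ≤ (R.map fun r : F => x - r).prod := by
  refine Multiset.prod_nonneg fun y hy => ?_
  obtain ⟨r, hr, rfl⟩ := Multiset.mem_map.1 hy
  exact sub_nonneg.2 (h r hr)

theorem prod_sub_pos {R : Multiset F} {x : ℝ} (h : ∀ r ∈ R, (r : ℝ) < x) :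
    0 < (R.map fun r : F => x - r).prod := by
  refine Multiset.prod_pos fun y hy => ?_
  obtain ⟨r, hr, rfl⟩ := Multiset.mem_map.1 hy
  exact sub_pos.2 (h r hr)

theorem exists_cons_max {R : Multiset F} (h : R ≠ 0) :
    ∃ r R', R = r ::ₘ R' ∧ ∀ s ∈ R', (s : ℝ) ≤ r := by
  classical
  obtain ⟨r, hr, hmax⟩ := R.toFinset.exists_max_image (fun s : F => (s : ℝ))
    (by simpa [Finset.nonempty_iff_ne_empty] using h)
  have hr' : r ∈ R := by simpa using hr
  refine ⟨r, R.erase r, (Multiset.cons_erase hr').symm, fun s hs => hmax s ?_⟩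
  simpa using Multiset.mem_of_mem_erase hs

/-- The roots, taken with multiplicity in decreasing order, group into pairs: between the two
roots of a pair the polynomial is negative, so no point of `K` lies there. A last unpaired root
is a lower bound of `K`. -/
theorem prod_X_sub_C_mem (hcl : IsClosed K) (hbd : frontier K ⊆ (F : Set ℝ))
    (hne : K.Nonempty) (hC : ∀ a : F, (0 : ℝ) ≤ (a : ℝ) → C a ∈ T) (hsq : ∀ q : F[X], q ^ 2 ∈ T)
    (hN : naturalGenerators F K ⊆ T) (R : Multiset F)
    (h : ∀ x ∈ K, 0 ≤ (R.map fun r : F => x - r).prod) :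
    (R.map fun r => X - C r).prod ∈ T := by
  induction hn : R.card using Nat.strong_induction_on generalizing R with
  | _ n ih =>
  rcases eq_or_ne R 0 with rfl | hR
  · simp
  obtain ⟨r, R', rfl, hr⟩ := exists_cons_max hR
  rcases eq_or_ne R' 0 with rfl | hR'
  · have : X - C r ∈ T := X_sub_C_mem_of_forall_le hcl hbd hne hC hN
      fun x hx => by simpa using h x hx
    simpa using this
  obtain ⟨s, R, rfl, hs⟩ := exists_cons_max hR'
  have hsr : (s : ℝ) ≤ r := hr s (by simp)
  simp only [Multiset.map_cons, Multiset.prod_cons] at h ⊢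
  have hgap : Set.Ioo (s : ℝ) r ∩ K = ∅ := by
    refine Set.eq_empty_iff_forall_notMem.2 fun x hx => ?_
    have h1 := h x hx.2
    have h2 : 0 < (R.map fun r : F => x - r).prod :=
      prod_sub_pos fun t ht => (hs t ht).trans_lt hx.1.1
    have h3 : (x - r) * ((x - s) * (R.map fun r : F => x - r).prod) < 0 :=
      mul_neg_of_neg_of_pos (sub_neg.2 hx.1.2) (mul_pos (sub_pos.2 hx.1.1) h2)
    exact absurd h1 (not_le.2 h3)
  have hrest : (R.map fun r => X - C r).prod ∈ T := by
    refine ih R.card (by simp at hn; omega) R (fun x hx => ?_) rfl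
    rcases le_or_gt (s : ℝ) x with h1 | h1
    · exact prod_sub_nonneg fun t ht => (hs t ht).trans h1
    · have h2 : 0 < (x - r) * (x - s) :=
        mul_pos_of_neg_of_neg (by linarith) (by linarith)
      have h3 := h x hx
      rw [← mul_assoc] at h3
      exact nonneg_of_mul_nonneg_right h3 h2
  have hpair := X_sub_C_mul_X_sub_C_mem hcl hbd hne hC hsq hN hsr hgap
  have := T.mul_mem hpair hrest
  rwa [mul_comm (X - C s), mul_assoc] at this

/-- Here the largest root is an upper bound of `K`; the remaining roots are paired as in
`prod_X_sub_C_mem`. -/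
theorem neg_prod_X_sub_C_mem (hcl : IsClosed K) (hbd : frontier K ⊆ (F : Set ℝ))
    (hne : K.Nonempty) (hC : ∀ a : F, (0 : ℝ) ≤ (a : ℝ) → C a ∈ T) (hsq : ∀ q : F[X], q ^ 2 ∈ T)
    (hN : naturalGenerators F K ⊆ T) (R : Multiset F)
    (h : ∀ x ∈ K, (R.map fun r : F => x - r).prod ≤ 0) :
    -(R.map fun r => X - C r).prod ∈ T := by
  rcases eq_or_ne R 0 with rfl | hR
  · obtain ⟨x, hx⟩ := hne
    have := h x hx
    norm_num at this
  obtain ⟨r, R, rfl, hr⟩ := exists_cons_max hR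
  simp only [Multiset.map_cons, Multiset.prod_cons] at h ⊢
  have hle : ∀ x ∈ K, x ≤ (r : ℝ) := fun x hx => by
    by_contra! hlt
    have h2 : 0 < (R.map fun r : F => x - r).prod :=
      prod_sub_pos fun t ht => (hr t ht).trans_lt hlt
    exact absurd (h x hx) (not_le.2 (mul_pos (sub_pos.2 hlt) h2))
  have hrest : (R.map fun r => X - C r).prod ∈ T := by
    refine prod_X_sub_C_mem hcl hbd hne hC hsq hN R fun x hx => ?_
    rcases (hle x hx).eq_or_lt with rfl | hlt
    · exact prod_sub_nonneg hr
    · exact nonneg_of_mul_nonpos_right (h x hx) (sub_neg.2 hlt)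
  have := T.mul_mem (C_sub_X_mem_of_forall_le hcl hbd hne hC hN hle) hrest
  rwa [← neg_sub X (C r), neg_mul] at this

end Split

/-! ### Approximating real polynomials over `F` -/

section Approximation

open Filter Topology

variable {F : Subfield ℝ}

/-- The polynomials `s k` over `F` converge to the real polynomial `p`, coefficient by
coefficient. -/
def CoeffTendsto (s : ℕ → F[X]) (p : ℝ[X]) : Prop :=
  ∀ i, Tendsto (fun k => ((s k).coeff i : ℝ)) atTop (𝓝 (p.coeff i))

theorem CoeffTendsto.add {s t : ℕ → F[X]} {p q : ℝ[X]} (hs : CoeffTendsto s p)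
    (ht : CoeffTendsto t q) : CoeffTendsto (fun k => s k + t k) (p + q) := fun i => by
  simpa using (hs i).add (ht i)

theorem CoeffTendsto.neg {s : ℕ → F[X]} {p : ℝ[X]} (hs : CoeffTendsto s p) :
    CoeffTendsto (fun k => -s k) (-p) := fun i => by
  simpa using (hs i).neg

theorem CoeffTendsto.mul {s t : ℕ → F[X]} {p q : ℝ[X]} (hs : CoeffTendsto s p)
    (ht : CoeffTendsto t q) : CoeffTendsto (fun k => s k * t k) (p * q) := fun i => by
  simp only [coeff_mul]
  push_cast
  exact tendsto_finsetSum _ fun x _ => (hs x.1).mul (ht x.2)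

theorem coeffTendsto_C {a : ℕ → F} {r : ℝ} (h : Tendsto (fun k => (a k : ℝ)) atTop (𝓝 r)) :
    CoeffTendsto (fun k => C (a k)) (C r) := fun i => by
  rcases eq_or_ne i 0 with rfl | hi
  · simpa using h
  · simp [coeff_C, hi]

theorem coeffTendsto_X : CoeffTendsto (fun _ => (X : F[X])) X := fun i => by
  simp only [coeff_X]
  split_ifs <;> simp

theorem coeffTendsto_X_sub_C {a : ℕ → F} {r : ℝ}
    (h : Tendsto (fun k => (a k : ℝ)) atTop (𝓝 r)) :
    CoeffTendsto (fun k => X - C (a k)) (X - C r) := by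
  simpa only [sub_eq_add_neg] using coeffTendsto_X.add (coeffTendsto_C h).neg

theorem coeffTendsto_prod {R : Multiset ℝ} {φ : ℕ → ℝ → F}
    (h : ∀ r ∈ R, Tendsto (fun k => (φ k r : ℝ)) atTop (𝓝 r)) :
    CoeffTendsto (fun k => (R.map fun r => X - C (φ k r)).prod)
      (R.map fun r => X - C r).prod := by
  induction R using Multiset.induction_on with
  | empty => simpa using coeffTendsto_C (a := fun _ => (1 : F)) (r := 1) (by simp)
  | cons r R ih =>
    simp only [Multiset.map_cons, Multiset.prod_cons]
    exact (coeffTendsto_X_sub_C (h r (by simp))).mul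
      (ih fun r hr => h r (Multiset.mem_cons_of_mem hr))

theorem exists_abs_sub_lt (F : Subfield ℝ) (r : ℝ) {e : ℝ} (he : 0 < e) :
    ∃ a : F, |(a : ℝ) - r| < e := by
  obtain ⟨q, h1, h2⟩ := exists_rat_btwn (show r < r + e by linarith)
  refine ⟨(q : F), ?_⟩
  push_cast
  rw [abs_lt]; constructor <;> linarith

theorem exists_seq_tendsto (F : Subfield ℝ) (r : ℝ) :
    ∃ a : ℕ → F, Tendsto (fun k => (a k : ℝ)) atTop (𝓝 r) := by
  choose a ha using fun k : ℕ => exists_abs_sub_lt F r (Nat.one_div_pos_of_nat (n := k))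
  refine ⟨a, tendsto_iff_dist_tendsto_zero.2 ?_⟩
  exact squeeze_zero (fun _ => dist_nonneg) (fun k => (ha k).le)
    tendsto_one_div_add_atTop_nhds_zero_nat

/-- A real polynomial without real roots and with positive leading coefficient is a limit of sums
of squares over `F` of no larger degree: the quadratic factors `(X - u) ^ 2 + v ^ 2` are. -/
theorem exists_coeffTendsto_of_roots_eq_zero {T : Subsemiring F[X]}
    (hC : ∀ a : F, (0 : ℝ) ≤ (a : ℝ) → C a ∈ T) (hsq : ∀ q : F[X], q ^ 2 ∈ T) (q : ℝ[X])
    (hq : q.roots = 0) (hl : 0 < q.leadingCoeff) :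
    (∀ x, 0 < q.eval x) ∧ ∃ s : ℕ → F[X], (∀ k, s k ∈ T) ∧
      (∀ k, (s k).natDegree ≤ q.natDegree) ∧ CoeffTendsto s q := by
  induction hn : q.natDegree using Nat.strong_induction_on generalizing q with
  | _ n ih =>
  have hq0 : q ≠ 0 := by rintro rfl; simp at hl
  rcases Nat.eq_zero_or_pos n with rfl | hpos
  · rw [eq_C_of_natDegree_eq_zero hn] at hl ⊢
    rw [leadingCoeff_C] at hl
    refine ⟨fun x => by simpa using hl, ?_⟩
    obtain ⟨a, ha⟩ := exists_seq_tendsto F √(q.coeff 0)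
    refine ⟨fun k => C (a k * a k), fun k => hC _ ?_, fun k => (natDegree_C _).le, coeffTendsto_C ?_⟩
    · push_cast; exact mul_self_nonneg _
    · have := ha.mul ha
      rw [Real.mul_self_sqrt hl.le] at this
      simpa using this
  have hdeg : q.degree ≠ 0 := fun h => by
    rw [natDegree_eq_of_degree_eq_some (n := 0) (by simpa using h)] at hn; omega
  obtain ⟨z, hz⟩ := IsAlgClosed.exists_aeval_eq_zero ℂ q hdeg
  have him : z.im ≠ 0 := fun him => by
    have hzre : z = algebraMap ℝ ℂ z.re := Complex.ext (by simp) (by simp [him])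
    rw [hzre, aeval_algebraMap_apply] at hz
    have : z.re ∈ q.roots := (mem_roots hq0).2 (by
      simpa [coe_aeval_eq_eval] using hz)
    simp [hq] at this
  obtain ⟨p, hp⟩ := quadratic_dvd_of_aeval_eq_zero_im_ne_zero q hz him
  have hquad : (X ^ 2 - C (2 * z.re) * X + C (‖z‖ ^ 2) : ℝ[X]) =
      (X - C z.re) * (X - C z.re) + C z.im * C z.im := by
    rw [Complex.sq_norm, Complex.normSq_apply]
    simp only [C_mul, C_add, map_ofNat]; ring
  rw [hquad] at hp
  set Q : ℝ[X] := (X - C z.re) * (X - C z.re) + C z.im * C z.im with hQ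
  have hQm : Q.Monic := by rw [← hquad]; monicity!
  have hQd : Q.natDegree = 2 := by rw [← hquad]; compute_degree!
  have hp0 : p ≠ 0 := by rintro rfl; simp [hp] at hq0
  have hnd : q.natDegree = 2 + p.natDegree := by
    rw [hp, natDegree_mul hQm.ne_zero hp0, hQd]
  have hpr : p.roots = 0 := by
    rw [hp, roots_mul (hp ▸ hq0)] at hq
    exact (add_eq_zero.1 hq).2
  have hpl : 0 < p.leadingCoeff := by
    rwa [hp, leadingCoeff_mul, hQm.leadingCoeff, one_mul] at hl
  obtain ⟨hpos', s, hsT, hsd, hs⟩ := ih p.natDegree (by omega) p hpr hpl rfl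
  refine ⟨fun x => ?_, ?_⟩
  · rw [hp, eval_mul]
    refine mul_pos ?_ (hpos' x)
    simp only [hQ, eval_add, eval_mul, eval_sub, eval_X, eval_C]
    nlinarith [mul_self_nonneg (x - z.re), mul_self_pos.2 him]
  obtain ⟨a, ha⟩ := exists_seq_tendsto F z.re
  obtain ⟨b, hb⟩ := exists_seq_tendsto F z.im
  refine ⟨fun k => ((X - C (a k)) * (X - C (a k)) + C (b k) * C (b k)) * s k, fun k => ?_,
    fun k => ?_, ?_⟩
  · refine T.mul_mem (T.add_mem ?_ ?_) (hsT k) <;> rw [← pow_two] <;> exact hsq _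
  · refine natDegree_mul_le.trans ?_
    have : ((X - C (a k)) * (X - C (a k)) + C (b k) * C (b k)).natDegree ≤ 2 := by
      compute_degree!
    have := hsd k
    omega
  · rw [hp]
    exact (((coeffTendsto_X_sub_C ha).mul (coeffTendsto_X_sub_C ha)).add
      ((coeffTendsto_C hb).mul (coeffTendsto_C hb))).mul hs

theorem exists_near_same_side {K : Set ℝ} (hcl : IsClosed K) {r : ℝ} (hr : r ∉ K) {e : ℝ}
    (he : 0 < e) :
    ∃ a : F, |(a : ℝ) - r| < e ∧ ∀ x ∈ K, 0 < (x - r) * (x - a) := by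
  obtain ⟨d, hd, hball⟩ := Metric.isOpen_iff.1 hcl.isOpen_compl r hr
  obtain ⟨a, ha⟩ := exists_abs_sub_lt F r (lt_min he hd)
  refine ⟨a, ha.trans_le (min_le_left _ _), fun x hx => ?_⟩
  have h1 : d ≤ |x - r| := by
    by_contra! hlt
    exact hball (by simpa [Real.dist_eq] using hlt) hx
  have h2 : |(a : ℝ) - r| < |x - r| := (ha.trans_le (min_le_right _ _)).trans_le h1
  rcases lt_abs.1 (hd.trans_le h1) with h3 | h3
  · rw [abs_of_pos h3] at h2
    exact mul_pos h3 (by linarith [le_abs_self ((a : ℝ) - r)])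
  · rw [abs_of_neg (show x - r < 0 by linarith)] at h2
    exact mul_pos_of_neg_of_neg (by linarith) (by linarith [neg_abs_le ((a : ℝ) - r)])

/-- The real roots of `g` lie outside `K`, so that they can be moved to points of `F` without
changing the sign of `g` at any point of `K`. -/
theorem exists_coeffTendsto_mul_mem {K : Set ℝ} {T : Subsemiring F[X]} (hcl : IsClosed K)
    (hbd : frontier K ⊆ (F : Set ℝ)) (hne : K.Nonempty)
    (hC : ∀ a : F, (0 : ℝ) ≤ (a : ℝ) → C a ∈ T) (hsq : ∀ q : F[X], q ^ 2 ∈ T)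
    (hN : naturalGenerators F K ⊆ T) (A : Multiset F) (g : ℝ[X])
    (hg : ∀ x ∈ K, g.eval x ≠ 0)
    (h : ∀ x ∈ K, 0 ≤ (A.map fun a : F => x - a).prod * g.eval x) :
    ∃ s : ℕ → F[X], (∀ k, (A.map fun a => X - C a).prod * s k ∈ T) ∧
      (∀ k, (s k).natDegree ≤ g.natDegree) ∧ CoeffTendsto s g := by
  obtain ⟨x₀, hx₀⟩ := hne
  have hg0 : g ≠ 0 := by rintro rfl; simpa using hg x₀ hx₀
  obtain ⟨q, hq, hdeg, hqr⟩ := exists_prod_multiset_X_sub_C_mul g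
  have hq0 : q ≠ 0 := by rintro rfl; simp at hq; exact hg0 hq.symm
  have hrK : ∀ r ∈ g.roots, r ∉ K := fun r hr hrK => hg r hrK (isRoot_of_mem_roots hr)
  have key : ∀ k : ℕ, ∃ φ : ℝ → F, ∀ r ∉ K, |(φ r : ℝ) - r| < 1 / ((k : ℝ) + 1) ∧
      ∀ x ∈ K, 0 < (x - r) * (x - φ r) := fun k => by
    classical
    have : ∀ r : ℝ, ∃ a : F, r ∉ K → |(a : ℝ) - r| < 1 / ((k : ℝ) + 1) ∧
        ∀ x ∈ K, 0 < (x - r) * (x - a) := fun r => by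
      by_cases hr : r ∈ K
      · exact ⟨0, fun h => absurd hr h⟩
      · obtain ⟨a, ha⟩ := exists_near_same_side (F := F) hcl hr (Nat.one_div_pos_of_nat (n := k))
        exact ⟨a, fun _ => ha⟩
    choose φ hφ using this
    exact ⟨φ, hφ⟩
  choose φ hφ using key
  have hlim : CoeffTendsto (fun k => (g.roots.map fun r => X - C (φ k r)).prod)
      (g.roots.map fun r => X - C r).prod := by
    refine coeffTendsto_prod fun r hr => tendsto_iff_dist_tendsto_zero.2 ?_
    exact squeeze_zero (fun _ => dist_nonneg) (fun k => (hφ k r (hrK r hr)).1.le)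
      tendsto_one_div_add_atTop_nhds_zero_nat
  have hdegφ : ∀ k, (g.roots.map fun r => X - C (φ k r)).prod.natDegree = g.roots.card := by
    intro k
    have := natDegree_multiset_prod_X_sub_C_eq_card (g.roots.map (φ k))
    rwa [Multiset.map_map, Multiset.card_map] at this
  have heval : ∀ x, g.eval x = (g.roots.map fun r => x - r).prod * q.eval x := fun x => by
    conv_lhs => rw [← hq]
    rw [eval_mul, eval_multiset_prod, Multiset.map_map]
    simp
  -- At the points of `K`, moving the roots does not change the sign of the split factor.
  have hsame : ∀ k, ∀ x ∈ K, 0 < (g.roots.map fun r => x - r).prod *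
      (g.roots.map fun r => x - φ k r).prod := fun k x hx => by
    rw [← Multiset.prod_map_mul]
    refine Multiset.prod_pos fun y hy => ?_
    obtain ⟨r, hr, rfl⟩ := Multiset.mem_map.1 hy
    exact (hφ k r (hrK r hr)).2 x hx
  have hjoin : ∀ k, (A.map fun a => X - C a).prod * (g.roots.map fun r => X - C (φ k r)).prod =
      ((A + g.roots.map (φ k)).map fun a => X - C a).prod := fun k => by
    rw [Multiset.map_add, Multiset.prod_add, Multiset.map_map]; rfl
  have hjoin' : ∀ k (x : ℝ), ((A + g.roots.map (φ k)).map fun a : F => x - a).prod =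
      (A.map fun a : F => x - a).prod * (g.roots.map fun r => x - φ k r).prod := fun k x => by
    rw [Multiset.map_add, Multiset.prod_add, Multiset.map_map]; rfl
  have hsign : ∀ k, ∀ x ∈ K, 0 ≤ ((A + g.roots.map (φ k)).map fun a : F => x - a).prod *
      q.eval x := fun k x hx => by
    have h1 := h x hx
    rw [heval] at h1
    have h2 := hsame k x hx
    rw [hjoin']
    set P := (g.roots.map fun r => x - r).prod
    set Q := (g.roots.map fun r => x - (φ k r : ℝ)).prod
    set U := (A.map fun a : F => x - a).prod
    have h3 : 0 ≤ (P ^ 2) * (U * Q * q.eval x) := by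
      have := mul_nonneg h1 h2.le
      linarith [this, show (P ^ 2) * (U * Q * q.eval x) = U * (P * q.eval x) * (P * Q) by ring]
    have hP : P ≠ 0 := fun h0 => by simp [h0] at h2
    exact nonneg_of_mul_nonneg_right h3 (by positivity)
  have hne : K.Nonempty := ⟨x₀, hx₀⟩
  rcases lt_or_gt_of_ne (leadingCoeff_ne_zero.2 hq0) with hl | hl
  · obtain ⟨hpos, t, htT, htd, ht⟩ := exists_coeffTendsto_of_roots_eq_zero hC hsq (-q)
      (by rwa [roots_neg]) (by rw [leadingCoeff_neg]; linarith)
    refine ⟨fun k => (g.roots.map fun r => X - C (φ k r)).prod * -t k, fun k => ?_, fun k => ?_,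
      ?_⟩
    · rw [← mul_assoc, hjoin, mul_neg, ← neg_mul]
      refine T.mul_mem (neg_prod_X_sub_C_mem hcl hbd hne hC hsq hN _ fun x hx => ?_) (htT k)
      have h1 := hpos x
      rw [eval_neg] at h1
      exact nonpos_of_mul_nonneg_left (hsign k x hx) (by linarith)
    · refine natDegree_mul_le.trans ?_
      have := htd k
      rw [natDegree_neg] at this ⊢
      have := hdegφ k
      omega
    · have := hlim.mul ht.neg
      rwa [neg_neg, hq] at this
  · obtain ⟨hpos, t, htT, htd, ht⟩ := exists_coeffTendsto_of_roots_eq_zero hC hsq q hqr hl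
    refine ⟨fun k => (g.roots.map fun r => X - C (φ k r)).prod * t k, fun k => ?_, fun k => ?_,
      ?_⟩
    · rw [← mul_assoc, hjoin]
      refine T.mul_mem (prod_X_sub_C_mem hcl hbd hne hC hsq hN _ fun x hx => ?_) (htT k)
      exact nonneg_of_mul_nonneg_left (hsign k x hx) (hpos x)
    · refine natDegree_mul_le.trans ?_
      have := htd k
      have := hdegφ k
      omega
    · have := hlim.mul ht
      rwa [hq] at this

/-- If `g` is surrounded by a simplex whose vertices are limits of members of a cone over `F`,
then nearby members of the cone surround `g` as well. Cramer's rule finds the barycentric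
coordinates of `g`, which therefore lie in `F`, and they are positive by continuity. -/
theorem mem_of_simplex_limit {M : AddSubmonoid F[X]}
    (hM : ∀ a : F, (0 : ℝ) ≤ (a : ℝ) → ∀ p ∈ M, C a * p ∈ M) {n : ℕ} {g : F[X]}
    (hg : g.natDegree ≤ n) {δ : ℝ} (hδ : 0 < δ) {s : Fin (n + 1) → ℕ → F[X]} {t : ℕ → F[X]}
    (hsM : ∀ j k, s j k ∈ M) (hsd : ∀ j k, (s j k).natDegree ≤ n)
    (hs : ∀ j, CoeffTendsto (s j) (g.map F.subtype + C δ * X ^ (j : ℕ)))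
    (htM : ∀ k, t k ∈ M) (htd : ∀ k, (t k).natDegree ≤ n)
    (ht : CoeffTendsto t (g.map F.subtype + C (-δ) * ∑ j : Fin (n + 1), X ^ (j : ℕ))) :
    g ∈ M := by
  classical
  -- The coordinates of `s j k - g` and of `g - t k`: in the limit `δ` times the identity matrix
  -- and `δ` times the all-ones vector, for which Cramer's rule gives positive numbers.
  let A : ℕ → Matrix (Fin (n + 1)) (Fin (n + 1)) F :=
    fun k => Matrix.of fun i j => (s j k).coeff i - g.coeff i
  let b : ℕ → Fin (n + 1) → F := fun k i => g.coeff i - (t k).coeff i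
  have hA : Tendsto (fun k => F.subtype.mapMatrix (A k)) atTop
      (𝓝 (δ • (1 : Matrix (Fin (n + 1)) (Fin (n + 1)) ℝ))) := by
    refine tendsto_pi_nhds.2 fun i => tendsto_pi_nhds.2 fun j => ?_
    have h1 := (hs j i).sub_const ((g.coeff i : F) : ℝ)
    have h2 : ((g.map F.subtype + C δ * X ^ (j : ℕ)).coeff i - ((g.coeff i : F) : ℝ)) =
        (δ • (1 : Matrix (Fin (n + 1)) (Fin (n + 1)) ℝ)) i j := by
      simp [coeff_X_pow, Matrix.one_apply, Fin.ext_iff]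
    rw [h2] at h1
    simpa [A] using h1
  have hb : Tendsto (fun k i => (b k i : ℝ)) atTop (𝓝 (fun _ => δ)) := by
    refine tendsto_pi_nhds.2 fun i => ?_
    have h1 := (ht i).const_sub ((g.coeff i : F) : ℝ)
    have h2 : ((g.coeff i : F) : ℝ) - (g.map F.subtype + C (-δ) *
        ∑ j : Fin (n + 1), X ^ (j : ℕ)).coeff i = δ := by
      have h3 : (∑ j : Fin (n + 1), (X : ℝ[X]) ^ (j : ℕ)).coeff i = 1 := by
        rw [finsetSum_coeff, Finset.sum_eq_single i] <;> simp [coeff_X_pow, Fin.ext_iff]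
        intro j hj h; exact absurd h.symm hj
      rw [coeff_add, coeff_C_mul, h3]
      simp
    rw [h2] at h1
    simpa [b] using h1
  have hdet : ∀ᶠ k in atTop, 0 < (F.subtype.mapMatrix (A k)).det := by
    have hc : Continuous fun B : Matrix (Fin (n + 1)) (Fin (n + 1)) ℝ => B.det :=
      continuous_id.matrix_det
    have h1 := (hc.tendsto _).comp hA
    refine h1.eventually (lt_mem_nhds ?_)
    rw [Matrix.det_smul, Matrix.det_one, mul_one]
    positivity
  have hcr : ∀ j, ∀ᶠ k in atTop,
      0 < (F.subtype.mapMatrix (A k)).cramer (fun i => (b k i : ℝ)) j := by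
    intro j
    have hc : Continuous fun B : Matrix (Fin (n + 1)) (Fin (n + 1)) ℝ × (Fin (n + 1) → ℝ) =>
        B.1.cramer B.2 := continuous_fst.matrix_cramer continuous_snd
    have h1 := ((continuous_apply j).comp hc).tendsto
      (δ • (1 : Matrix (Fin (n + 1)) (Fin (n + 1)) ℝ), fun _ => δ)
    have h2 := h1.comp (hA.prodMk_nhds hb)
    refine h2.eventually (lt_mem_nhds ?_)
    simp only [Function.comp, Matrix.cramer_smul, Matrix.cramer_one]
    simp
    positivity
  obtain ⟨k, hk1, hk2⟩ := (hdet.and (eventually_all.2 hcr)).exists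
  set c : Fin (n + 1) → F := (A k).cramer (b k) with hc
  set D : F := (A k).det with hD
  have hDpos : (0 : ℝ) < (D : ℝ) := by
    have := F.subtype.map_det (A k)
    rw [← this] at hk1
    exact hk1
  have hcpos : ∀ j, (0 : ℝ) < (c j : ℝ) := fun j => by
    have h1 := hk2 j
    have h2 : (F.subtype.mapMatrix (A k)).cramer (fun i => (b k i : ℝ)) j = (c j : ℝ) := by
      rw [hc, Matrix.cramer_eq_adjugate_mulVec, Matrix.cramer_eq_adjugate_mulVec,
        ← RingHom.map_adjugate]
      simp [Matrix.mulVec, dotProduct]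
    rwa [h2] at h1
  have hsolve : ∑ j, C (c j) * (s j k - g) = C D * (g - t k) := by
    ext1 i
    rcases lt_or_ge i (n + 1) with hi | hi
    · have h1 := congrFun (Matrix.mulVec_cramer (A k) (b k)) ⟨i, hi⟩
      simp only [Matrix.mulVec, dotProduct, Pi.smul_apply, smul_eq_mul] at h1
      rw [finsetSum_coeff]
      simp only [coeff_C_mul, coeff_sub]
      rw [← hD, ← hc] at h1
      rw [← h1]
      exact Finset.sum_congr rfl fun j _ => mul_comm _ _
    · have h0 : ∀ p : F[X], p.natDegree ≤ n → p.coeff i = 0 := fun p hp =>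
        coeff_eq_zero_of_natDegree_lt (by omega)
      rw [finsetSum_coeff]
      simp [coeff_C_mul, coeff_sub, h0 _ hg, h0 _ (htd k), h0 _ (hsd _ k)]
  set E : F := D + ∑ j, c j with hE
  have hEpos : (0 : ℝ) < (E : ℝ) := by
    rw [hE]; push_cast
    exact add_pos_of_pos_of_nonneg hDpos (Finset.sum_nonneg fun j _ => (hcpos j).le)
  have hE0 : E ≠ 0 := fun h0 => by rw [h0] at hEpos; simp at hEpos
  have hcomb : C E * g = ∑ j, C (c j) * s j k + C D * t k := by
    simp only [mul_sub, Finset.sum_sub_distrib] at hsolve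
    rw [hE, C_add, map_sum, add_mul, Finset.sum_mul]
    linear_combination -hsolve
  have hmem : C E * g ∈ M := by
    rw [hcomb]
    exact M.add_mem (M.sum_mem fun j _ => hM _ (hcpos j).le _ (hsM j k))
      (hM _ hDpos.le _ (htM k))
  have := hM E⁻¹ (by push_cast; positivity) _ hmem
  rwa [← mul_assoc, ← C_mul, inv_mul_cancel₀ hE0, C_1, one_mul] at this

end Approximation

/-! ### Saturated preorderings -/

section Saturation

open Filter Topology

variable {F : Subfield ℝ} {K : Set ℝ}

theorem exists_abs_eval_le_mul {g h : ℝ[X]} (hcl : IsClosed K) (hdeg : h.natDegree ≤ g.natDegree)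
    (hg0 : g ≠ 0) (hg : ∀ x ∈ K, g.eval x ≠ 0) :
    ∃ c : ℝ, 0 ≤ c ∧ ∀ x ∈ K, |h.eval x| ≤ c * |g.eval x| := by
  obtain ⟨c₁, h₁⟩ := (isBigO_cobounded_of_degree_le (P := h) (Q := g)
    ((degree_le_of_natDegree_le hdeg).trans (degree_eq_natDegree hg0).ge)).bound
  obtain ⟨r, -, hr⟩ := (Metric.hasBasis_cobounded_compl_closedBall (0 : ℝ)).eventually_iff.1 h₁
  obtain ⟨c₂, h₂⟩ := ((isCompact_closedBall (0 : ℝ) r).inter_left hcl).exists_bound_of_continuousOn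
    (f := fun x => h.eval x / g.eval x)
    (h.continuous.continuousOn.div g.continuous.continuousOn fun x hx => hg x hx.1)
  refine ⟨max 0 (max c₁ c₂), le_max_left _ _, fun x hx => ?_⟩
  have hle : ∀ c, |h.eval x| ≤ c * |g.eval x| → c ≤ max 0 (max c₁ c₂) →
      |h.eval x| ≤ max 0 (max c₁ c₂) * |g.eval x| := fun c h1 h2 =>
    h1.trans (mul_le_mul_of_nonneg_right h2 (abs_nonneg _))
  by_cases h3 : x ∈ Metric.closedBall (0 : ℝ) r
  · refine hle c₂ ?_ (by simp)
    have := h₂ x ⟨hx, h3⟩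
    rwa [Real.norm_eq_abs, abs_div, div_le_iff₀ (abs_pos.2 (hg x hx))] at this
  · exact hle c₁ (hr h3) (by simp)

theorem perturb_ne_zero_and_nonneg {u g h c δ : ℝ} (hδ : 0 < δ) (hg : g ≠ 0) (hu : 0 ≤ u * g)
    (hh : |h| ≤ c * |g|) (hc : δ * c < 1) : g + δ * h ≠ 0 ∧ 0 ≤ u * (g + δ * h) := by
  have hg' := abs_pos.2 hg
  have h1 : |δ * h| < |g| := by
    rw [abs_mul, abs_of_pos hδ]
    calc δ * |h| ≤ δ * (c * |g|) := mul_le_mul_of_nonneg_left hh hδ.le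
      _ = (δ * c) * |g| := by ring
      _ < 1 * |g| := mul_lt_mul_of_pos_right hc hg'
      _ = |g| := one_mul _
  constructor
  · intro h0
    rw [eq_neg_of_add_eq_zero_left h0, abs_neg] at h1
    exact lt_irrefl _ h1
  · have h2 : |u * (δ * h)| ≤ u * g := by
      rw [abs_mul u (δ * h), ← abs_of_nonneg hu, abs_mul u g]
      exact mul_le_mul_of_nonneg_left h1.le (abs_nonneg _)
    linarith [neg_abs_le (u * (δ * h)), mul_add u g (δ * h)]

/-- Since `g` has no zero on `K`, the real polynomials close to `g` of at most its degree have the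
same sign as `g` on `K`, hence are limits of polynomials over `F` whose products with the split
factor lie in `T`. -/
theorem prod_X_sub_C_mul_mem {T : Subsemiring F[X]} (hcl : IsClosed K)
    (hbd : frontier K ⊆ (F : Set ℝ)) (hne : K.Nonempty)
    (hC : ∀ a : F, (0 : ℝ) ≤ (a : ℝ) → C a ∈ T) (hsq : ∀ q : F[X], q ^ 2 ∈ T)
    (hN : naturalGenerators F K ⊆ T) (A : Multiset F) (g : F[X])
    (hg : ∀ x ∈ K, aeval x g ≠ 0)
    (h : ∀ x ∈ K, 0 ≤ (A.map fun a : F => x - a).prod * aeval x g) :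
    (A.map fun a => X - C a).prod * g ∈ T := by
  have hev : ∀ x : ℝ, (g.map F.subtype).eval x = aeval x g := fun x => by
    rw [eval_map, aeval_def]; rfl
  have hnd : (g.map F.subtype).natDegree = g.natDegree := natDegree_map _
  have hg0 : g.map F.subtype ≠ 0 := by
    obtain ⟨x, hx⟩ := hne
    intro h0
    apply hg x hx
    rw [← hev, h0, eval_zero]
  set n := g.natDegree with hn
  have hb : ∀ j : Fin (n + 1), ∃ c : ℝ, 0 ≤ c ∧ ∀ x ∈ K,
      |x ^ (j : ℕ)| ≤ c * |aeval x g| := fun j => by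
    obtain ⟨c, hc0, hc⟩ := exists_abs_eval_le_mul (h := X ^ (j : ℕ)) hcl
      (by rw [natDegree_X_pow, hnd]; omega) hg0 (fun x hx => by rw [hev]; exact hg x hx)
    exact ⟨c, hc0, fun x hx => by simpa [hev] using hc x hx⟩
  choose c hc0 hc using hb
  have hc' : ∀ x ∈ K, |-∑ j : Fin (n + 1), x ^ (j : ℕ)| ≤ (∑ j, c j) * |aeval x g| :=
    fun x hx => by
      rw [abs_neg, Finset.sum_mul]
      exact (Finset.abs_sum_le_sum_abs _ _).trans (Finset.sum_le_sum fun j _ => hc j x hx)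
  have hS : 0 ≤ ∑ j, c j := Finset.sum_nonneg fun j _ => hc0 j
  -- So small that moving `g` by `δ` in each of the directions `X ^ j` and `-∑ j, X ^ j` keeps its
  -- sign on `K`.
  set δ : ℝ := 1 / (∑ j, c j + 1) with hδdef
  have hδ : 0 < δ := by positivity
  have hδS : δ * ∑ j, c j < 1 := by
    rw [hδdef, one_div_mul_eq_div, div_lt_one (by positivity)]; linarith
  have hδc : ∀ j, δ * c j < 1 := fun j =>
    (mul_le_mul_of_nonneg_left (Finset.single_le_sum (fun i _ => hc0 i) (Finset.mem_univ j))
      hδ.le).trans_lt hδS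
  have hvert : ∀ p : ℝ[X], p.natDegree ≤ n → ∀ b : ℝ, δ * b < 1 →
      (∀ x ∈ K, |p.eval x| ≤ b * |aeval x g|) →
      ∃ s : ℕ → F[X], (∀ k, (A.map fun a => X - C a).prod * s k ∈ T) ∧
      (∀ k, (s k).natDegree ≤ n) ∧ CoeffTendsto s (g.map F.subtype + C δ * p) := by
    intro p hp b hb hpb
    have hx : ∀ x ∈ K, _ := fun x hx =>
      perturb_ne_zero_and_nonneg hδ (hg x hx) (h x hx) (hpb x hx) hb
    obtain ⟨s, hs1, hs2, hs3⟩ := exists_coeffTendsto_mul_mem hcl hbd hne hC hsq hN A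
      (g.map F.subtype + C δ * p)
      (fun x hxK => by simpa [hev] using (hx x hxK).1)
      (fun x hxK => by simpa [hev] using (hx x hxK).2)
    refine ⟨s, hs1, fun k => (hs2 k).trans ?_, hs3⟩
    exact natDegree_add_le_of_degree_le hnd.le ((natDegree_C_mul_le _ _).trans hp)
  choose s hs1 hs2 hs3 using fun j : Fin (n + 1) => hvert (X ^ (j : ℕ))
    (by rw [natDegree_X_pow]; omega) (c j) (hδc j) (fun x hx => by simpa using hc j x hx)
  obtain ⟨t, ht1, ht2, ht3⟩ := hvert (-∑ j : Fin (n + 1), X ^ (j : ℕ))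
    (by
      rw [natDegree_neg]
      exact natDegree_sum_le_of_forall_le _ _ fun j _ => by rw [natDegree_X_pow]; omega)
    _ hδS (fun x hx => by simpa [eval_finsetSum] using hc' x hx)
  have := mem_of_simplex_limit
    (M := T.toAddSubmonoid.comap (AddMonoidHom.mulLeft (A.map fun a => X - C a).prod))
    (fun a ha p hp => by
      have h1 : (A.map fun a => X - C a).prod * (C a * p) =
        C a * ((A.map fun a => X - C a).prod * p) := by ring
      change _ * (C a * p) ∈ T
      rw [h1]
      exact T.mul_mem (hC a ha) hp)
    hn.ge hδ hs1 hs2 hs3 ht1 ht2 (by simpa using ht3)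
  exact this

/-- A zero of `f` in the interior of `K` is at least double; by separability its minimal
polynomial over `F` divides `f` twice. -/
theorem exists_sq_minpoly_mul_eq {f : F[X]} (hf0 : f ≠ 0) (hf : f ∈ posOn F K) {ξ : ℝ}
    (hξ : ξ ∈ interior K) (h0 : aeval ξ f = 0) : ∃ h : F[X], f = minpoly F ξ ^ 2 * h := by
  have hint : IsIntegral F ξ := IsAlgebraic.isIntegral ⟨f, hf0, h0⟩
  obtain ⟨g, hg⟩ := minpoly.dvd F ξ h0
  have hmin : IsLocalMin (fun x : ℝ => aeval x f) ξ := by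
    filter_upwards [mem_interior_iff_mem_nhds.1 hξ] with x hx
    rw [h0]
    exact hf x hx
  have hd := hmin.deriv_eq_zero
  rw [Polynomial.deriv_aeval, hg, derivative_mul, map_add, map_mul, map_mul, minpoly.aeval,
    zero_mul, add_zero] at hd
  have hsep := (minpoly.irreducible hint).separable.aeval_derivative_ne_zero (minpoly.aeval F ξ)
  obtain ⟨h, rfl⟩ := minpoly.dvd F ξ ((mul_eq_zero.1 hd).resolve_left hsep)
  exact ⟨h, by rw [hg]; ring⟩

theorem mem_posOn_of_sq_mul {p h : F[X]} (hp : p ≠ 0) (hf : p ^ 2 * h ∈ posOn F K)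
    (hpK : ∀ x ∈ K, aeval x p = 0 → x ∈ interior K) : h ∈ posOn F K := by
  intro y hy
  by_contra! hlt
  have hzero : ∀ x ∈ K, aeval x h < 0 → aeval x p = 0 := fun x hx hxh => by
    have := hf x hx
    rw [map_mul, map_pow] at this
    by_contra hne
    exact absurd this (not_le.2 (mul_neg_of_pos_of_neg (by positivity) hxh))
  have hnear : {x : ℝ | aeval x p = 0} ∈ 𝓝 y := by
    filter_upwards [mem_interior_iff_mem_nhds.1 (hpK y hy (hzero y hy hlt)),
      h.continuous_aeval.continuousAt.eventually (gt_mem_nhds hlt)] with x hx hxh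
    exact hzero x hx hxh
  refine infinite_of_mem_nhds y hnear ?_
  refine (p.rootSet_finite ℝ).subset fun x hx => ?_
  exact (mem_rootSet_of_ne hp).2 hx

/-- A preordering over `F` that contains the natural generators of `K` is saturated. -/
theorem posOn_subset {T : Subsemiring F[X]} (hcl : IsClosed K)
    (hbd : frontier K ⊆ (F : Set ℝ)) (hne : K.Nonempty)
    (hC : ∀ a : F, (0 : ℝ) ≤ (a : ℝ) → C a ∈ T) (hsq : ∀ q : F[X], q ^ 2 ∈ T)
    (hN : naturalGenerators F K ⊆ T) : posOn F K ⊆ T := by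
  intro f
  induction hn : f.natDegree using Nat.strong_induction_on generalizing f with
  | _ n ih =>
  intro hf
  rcases eq_or_ne f 0 with rfl | hf0
  · exact T.zero_mem
  obtain ⟨g, hg, -, hgr⟩ := exists_prod_multiset_X_sub_C_mul f
  have hg0 : g ≠ 0 := by rintro rfl; exact hf0 (by rw [← hg, mul_zero])
  by_cases hz : ∃ ξ ∈ K, aeval ξ g = 0
  · obtain ⟨ξ, hξ, hξg⟩ := hz
    have hnF : ∀ a : F, ξ ≠ (a : ℝ) := by
      rintro a rfl
      have : a ∈ g.roots := (mem_roots hg0).2 (by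
        have h1 : aeval (algebraMap F ℝ a) g = 0 := hξg
        rw [aeval_algebraMap_apply] at h1
        simpa [coe_aeval_eq_eval] using h1)
      simp [hgr] at this
    have hnotF : ξ ∉ (F : Set ℝ) := fun h => hnF ⟨ξ, h⟩ rfl
    -- The boundary of `K` lies in `F`, so that zeros outside `F` are interior.
    have hint : ∀ x ∈ K, x ∉ (F : Set ℝ) → x ∈ interior K := fun x hx hxF => by
      by_contra hni
      exact hxF (hbd ⟨subset_closure hx, hni⟩)
    have hfξ : aeval ξ f = 0 := by rw [← hg, map_mul, hξg, mul_zero]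
    have hI : IsIntegral F ξ := IsAlgebraic.isIntegral ⟨f, hf0, hfξ⟩
    obtain ⟨h, rfl⟩ := exists_sq_minpoly_mul_eq hf0 hf (hint ξ hξ hnotF) hfξ
    have hp0 := minpoly.ne_zero hI
    have hh0 : h ≠ 0 := right_ne_zero_of_mul hf0
    have hpos := minpoly.natDegree_pos hI
    refine T.mul_mem (hsq _) (ih h.natDegree ?_ rfl
      (mem_posOn_of_sq_mul hp0 hf fun x hx hx0 => hint x hx fun hxF => ?_))
    · rw [natDegree_mul (pow_ne_zero 2 hp0) hh0, natDegree_pow] at hn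
      omega
    · have h1 : aeval (algebraMap F ℝ ⟨x, hxF⟩) (minpoly F ξ) = 0 := hx0
      rw [aeval_algebraMap_apply] at h1
      have h2 : (minpoly F ξ).IsRoot ⟨x, hxF⟩ := by simpa [coe_aeval_eq_eval] using h1
      exact hnF ⟨x, hxF⟩ (minpoly.root hI h2).symm
  · push Not at hz
    rw [← hg]
    refine prod_X_sub_C_mul_mem hcl hbd hne hC hsq hN _ g hz fun x hx => ?_
    have := hf x hx
    rw [← hg, map_mul, map_multiset_prod, Multiset.map_map] at this
    simp only [Function.comp_def, map_sub, aeval_X, aeval_C] at this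
    exact this

end Saturation

/-! ### Preorderings and quadratic modules -/

section Closures

variable {F : Subfield ℝ} {K : Set ℝ}

theorem closure_mul_mem {G : Set F[X]}
    (h : ∀ x ∈ G, ∀ y ∈ G, x * y ∈ AddSubmonoid.closure G) {p q : F[X]}
    (hp : p ∈ AddSubmonoid.closure G) (hq : q ∈ AddSubmonoid.closure G) :
    p * q ∈ AddSubmonoid.closure G := by
  induction hp using AddSubmonoid.closure_induction with
  | zero => simp
  | add x y _ _ hx hy => rw [add_mul]; exact add_mem hx hy
  | mem x hx =>
    induction hq using AddSubmonoid.closure_induction with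
    | zero => simp
    | add y z _ _ hy hz => rw [mul_add]; exact add_mem hy hz
    | mem y hy => exact h x hx y hy

/-- A property of a finite sum that only a summand can be responsible for holds for one of the
summands; what is left is again such a sum. -/
theorem exists_term_of_mem_closure {G : Set F[X]} {P : F[X] → Prop} (h0 : ¬ P 0)
    (hadd : ∀ x y, P (x + y) → P x ∨ P y) {p : F[X]} (hp : p ∈ AddSubmonoid.closure G)
    (hP : P p) : ∃ t ∈ G, P t ∧ p - t ∈ AddSubmonoid.closure G := by
  induction hp using AddSubmonoid.closure_induction with
  | zero => exact absurd hP h0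
  | mem x hx => exact ⟨x, hx, hP, by simp⟩
  | add x y hx hy ihx ihy =>
    rcases hadd x y hP with h | h
    · obtain ⟨t, ht, htP, hr⟩ := ihx h
      exact ⟨t, ht, htP, by rw [add_sub_right_comm]; exact add_mem hr hy⟩
    · obtain ⟨t, ht, htP, hr⟩ := ihy h
      exact ⟨t, ht, htP, by rw [add_sub_assoc]; exact add_mem hx hr⟩

theorem closure_subset_posOn {G : Set F[X]} (h : G ⊆ posOn F K) {p : F[X]}
    (hp : p ∈ AddSubmonoid.closure G) : p ∈ posOn F K := by
  induction hp using AddSubmonoid.closure_induction with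
  | zero => intro x _; simp
  | mem x hx => exact h hx
  | add x y _ _ hx hy => intro z hz; rw [map_add]; exact add_nonneg (hx z hz) (hy z hz)

/-- The preordering `T_S` as a subsemiring. A product of two products of distinct generators is
a product of distinct generators times a square. -/
def preorderingSubsemiring (S : Set F[X]) : Subsemiring F[X] where
  carrier := preordering S
  zero_mem' := zero_mem (AddSubmonoid.closure _)
  add_mem' := fun ha hb => add_mem (S := AddSubmonoid F[X]) ha hb
  one_mem' := AddSubmonoid.subset_closure ⟨1, 1, ∅, by simp, by simp, by simp⟩
  mul_mem' := by
    classical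
    refine fun ha hb => closure_mul_mem ?_ ha hb
    rintro _ ⟨a, q, t, ha, ht, rfl⟩ _ ⟨b, p, u, hb, hu, rfl⟩
    refine AddSubmonoid.subset_closure ⟨a * b, q * p * ∏ g ∈ t ∩ u, g, symmDiff t u,
      by push_cast; exact mul_nonneg ha hb, ?_, ?_⟩
    · intro g hg
      rcases Finset.mem_symmDiff.1 hg with h | h
      · exact ht h.1
      · exact hu h.1
    · have h1 : (∏ g ∈ t, g) * ∏ g ∈ u, g = (∏ g ∈ t ∪ u, g) * ∏ g ∈ t ∩ u, g :=
        (Finset.prod_union_inter).symm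
      have h2 : ∏ g ∈ t ∪ u, g = (∏ g ∈ symmDiff t u, g) * ∏ g ∈ t ∩ u, g := by
        have hdisj : Disjoint (symmDiff t u) (t ∩ u) := disjoint_symmDiff_inf t u
        have hunion : symmDiff t u ∪ t ∩ u = t ∪ u := symmDiff_sup_inf t u
        rw [← Finset.prod_union hdisj, hunion]
      rw [h2] at h1
      rw [C_mul]
      linear_combination (C a * C b * q ^ 2 * p ^ 2) * h1

theorem C_mem_preordering (S : Set F[X]) {a : F} (ha : (0 : ℝ) ≤ (a : ℝ)) :
    C a ∈ preorderingSubsemiring S :=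
  AddSubmonoid.subset_closure ⟨a, 1, ∅, ha, by simp, by simp⟩

theorem sq_mem_preordering (S : Set F[X]) (q : F[X]) : q ^ 2 ∈ preorderingSubsemiring S :=
  AddSubmonoid.subset_closure ⟨1, q, ∅, by simp, by simp, by simp⟩

theorem subset_preordering (S : Set F[X]) {g : F[X]} (hg : g ∈ S) :
    g ∈ preorderingSubsemiring S :=
  AddSubmonoid.subset_closure ⟨1, 1, {g}, by simp, by simpa using hg, by simp⟩

theorem preordering_terms_subset_posOn {S : Set F[X]} :
    {p : F[X] | ∃ (a : F) (q : F[X]) (t : Finset F[X]),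
      (0 : ℝ) ≤ (a : ℝ) ∧ (t : Set F[X]) ⊆ S ∧ p = C a * q ^ 2 * ∏ g ∈ t, g} ⊆
    posOn F (basicClosed S) := by
  rintro _ ⟨a, q, t, ha, ht, rfl⟩ x hx
  rw [map_mul, map_mul, map_pow, map_prod, aeval_C]
  exact mul_nonneg (mul_nonneg ha (sq_nonneg _)) (Finset.prod_nonneg fun g hg => hx g (ht hg))

theorem mul_mem_quadraticModule {N : Set F[X]} {a : F} (ha : (0 : ℝ) ≤ (a : ℝ)) (q : F[X])
    {g : F[X]} (hg : g ∈ insert 1 N) : C a * q ^ 2 * g ∈ quadraticModule N :=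
  AddSubmonoid.subset_closure ⟨a, q, g, ha, hg, rfl⟩

theorem scale_mem_quadraticModule {N : Set F[X]} {a : F} (ha : (0 : ℝ) ≤ (a : ℝ)) (q : F[X])
    {p : F[X]} (hp : p ∈ quadraticModule N) : C a * q ^ 2 * p ∈ quadraticModule N := by
  change p ∈ AddSubmonoid.closure _ at hp
  change _ ∈ AddSubmonoid.closure _
  induction hp using AddSubmonoid.closure_induction with
  | zero => simp
  | add x y _ _ hx hy => rw [mul_add]; exact add_mem hx hy
  | mem x hx =>
    obtain ⟨b, r, g, hb, hg, rfl⟩ := hx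
    refine AddSubmonoid.subset_closure ⟨a * b, q * r, g, by push_cast; exact mul_nonneg ha hb,
      hg, ?_⟩
    rw [C_mul]; ring

/-- The quadratic module `M_N` as a subsemiring, if it contains the products of its generators. -/
def quadraticModuleSubsemiring (N : Set F[X])
    (h : ∀ g ∈ N, ∀ g' ∈ N, g * g' ∈ quadraticModule N) : Subsemiring F[X] where
  carrier := quadraticModule N
  zero_mem' := zero_mem (AddSubmonoid.closure _)
  add_mem' := fun ha hb => add_mem (S := AddSubmonoid F[X]) ha hb
  one_mem' := AddSubmonoid.subset_closure ⟨1, 1, 1, by simp, by simp, by simp⟩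
  mul_mem' := by
    refine fun ha hb => closure_mul_mem ?_ ha hb
    rintro _ ⟨a, q, g, ha, hg, rfl⟩ _ ⟨b, p, g', hb, hg', rfl⟩
    have h1 : C a * q ^ 2 * g * (C b * p ^ 2 * g') = C (a * b) * (q * p) ^ 2 * (g * g') := by
      rw [C_mul]; ring
    have hab : (0 : ℝ) ≤ ((a * b : F) : ℝ) := by push_cast; exact mul_nonneg ha hb
    rw [h1]
    refine scale_mem_quadraticModule hab _ ?_
    rcases hg with rfl | hg
    · rw [one_mul]
      simpa using mul_mem_quadraticModule (a := 1) (by simp) 1 hg'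
    rcases hg' with rfl | hg'
    · rw [mul_one]
      simpa using mul_mem_quadraticModule (a := 1) (by simp) 1 (Or.inr hg)
    exact h g hg g' hg'

theorem naturalGenerators_subset_posOn : naturalGenerators F K ⊆ posOn F K := by
  rintro p (((⟨-, rfl⟩ | ⟨a, -, h, rfl⟩) | ⟨a, -, h, rfl⟩) | ⟨a, b, -, -, hab, h, rfl⟩) x hx <;>
    simp only [map_mul, map_sub, map_one, aeval_X, aeval_C]
  · exact zero_le_one
  all_goals have h := Set.eq_empty_iff_forall_notMem.1 h x
  · exact sub_nonneg.2 (not_lt.1 fun hlt => h ⟨hlt, hx⟩)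
  · exact sub_nonneg.2 (not_lt.1 fun hlt => h ⟨hlt, hx⟩)
  · change 0 ≤ (x - (a : ℝ)) * (x - (b : ℝ))
    rcases le_or_gt x a with h1 | h1
    · exact mul_nonneg_of_nonpos_of_nonpos (by linarith) (by linarith)
    · have h2 : (b : ℝ) ≤ x := not_lt.1 fun hlt => h ⟨⟨h1, hlt⟩, hx⟩
      exact mul_nonneg (by linarith) (by linarith)

theorem quadraticModule_terms_subset_posOn :
    {p : F[X] | ∃ (a : F) (q g : F[X]), (0 : ℝ) ≤ (a : ℝ) ∧
      g ∈ insert 1 (naturalGenerators F K) ∧ p = C a * q ^ 2 * g} ⊆ posOn F K := by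
  rintro _ ⟨a, q, g, ha, hg, rfl⟩ x hx
  rw [map_mul, map_mul, map_pow, aeval_C]
  refine mul_nonneg (mul_nonneg ha (sq_nonneg _)) ?_
  rcases hg with rfl | hg
  · simp
  · exact naturalGenerators_subset_posOn hg x hx

theorem natDegree_naturalGenerators_le {g : F[X]} (hg : g ∈ naturalGenerators F K) :
    g.natDegree ≤ 2 := by
  rcases hg with ((⟨-, rfl⟩ | ⟨a, -, -, rfl⟩) | ⟨a, -, -, rfl⟩) | ⟨a, b, -, -, -, -, rfl⟩ <;>
    compute_degree!

open Bornology in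
/-- On an unbounded set leading terms of nonnegative summands cannot cancel. -/
theorem natDegree_le_of_le_on_unbounded (hK : ¬ IsBounded K) {t f : F[X]} (ht : t ∈ posOn F K)
    (hf : f - t ∈ posOn F K) : t.natDegree ≤ f.natDegree := by
  by_contra! hlt
  have hev : ∀ (p : F[X]) (x : ℝ), (p.map F.subtype).eval x = aeval x p := fun p x => by
    rw [eval_map, aeval_def]; rfl
  have ht0 : t.map F.subtype ≠ 0 := by
    rw [Polynomial.map_ne_zero_iff F.subtype.injective]
    rintro rfl
    simp at hlt
  have hd : (f.map F.subtype).degree < (t.map F.subtype).degree := by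
    rw [degree_map, degree_map]
    exact degree_lt_degree hlt
  have h1 := (isLittleO_cobounded_of_degree_lt hd).bound (show (0 : ℝ) < 1 / 2 by norm_num)
  have h2 := (eventually_cofinite_not_isRoot ht0).filter_mono (le_cofinite ℝ)
  refine hK (isBounded_def.2 ?_)
  filter_upwards [h1, h2] with x hx1 hx2 hxK
  rw [IsRoot.def, hev] at hx2
  rw [hev, hev, Real.norm_eq_abs, Real.norm_eq_abs] at hx1
  have h3 := ht x hxK
  have h4 := hf x hxK
  rw [map_sub] at h4
  rw [abs_of_nonneg h3, abs_of_nonneg (by linarith)] at hx1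
  exact hx2 (by linarith)

end Closures

/-! ### Necessity, and the order of the gaps -/

section Gaps

variable {F : Subfield ℝ} {K : Set ℝ}

theorem mem_of_mem_frontier (hcl : IsClosed K) {x : ℝ} (h : x ∈ frontier K) : x ∈ K :=
  hcl.frontier_subset h

/-- Let `g`, negative at `m`, lie in the preordering of `S`. Some summand of a representation of
`g`, hence some generator `h` occurring in it, is negative at `m`. By `hdiv` the summand is a scalar
multiple of `g`, so `h` divides `g`, and by `hdeg` the cofactor is constant. -/
theorem exists_scaling_mem {S : Set F[X]} {g : F[X]} (hg : g ∈ preordering S)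
    {m : ℝ} (hm : aeval m g < 0)
    (hdiv : ∀ t ∈ posOn F (basicClosed S), g - t ∈ posOn F (basicClosed S) →
      ∃ e : F, t = C e * g)
    (hdeg : ∀ h ∈ posOn F (basicClosed S), aeval m h < 0 → g.natDegree ≤ h.natDegree) :
    ∃ c : F, (0 : ℝ) < (c : ℝ) ∧ C c * g ∈ S := by
  obtain ⟨_, ⟨a, q, E, ha, hE, rfl⟩, htm, hrest⟩ :=
    exists_term_of_mem_closure (P := fun p => aeval m p < 0) (by simp)
      (fun x y hxy => by
        rw [map_add] at hxy
        by_contra! hcon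
        linarith [hcon.1, hcon.2]) hg hm
  have ht := preordering_terms_subset_posOn ⟨a, q, E, ha, hE, rfl⟩
  obtain ⟨e, he⟩ := hdiv _ ht (closure_subset_posOn preordering_terms_subset_posOn hrest)
  obtain ⟨h, hhE, hhm⟩ : ∃ h ∈ E, aeval m h < 0 := by
    by_contra! hcon
    rw [map_mul, map_mul, map_pow, map_prod, aeval_C] at htm
    exact absurd htm (not_lt.2 (mul_nonneg (mul_nonneg ha (sq_nonneg _))
      (Finset.prod_nonneg hcon)))
  have he0 : e ≠ 0 := by
    rintro rfl
    rw [he] at htm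
    simp at htm
  obtain ⟨k, hk⟩ : h ∣ g := by
    have h1 : h ∣ C e * g := he ▸ (Finset.dvd_prod_of_mem _ hhE).mul_left _
    exact ((isUnit_C.2 (isUnit_iff_ne_zero.2 he0)).dvd_mul_left).1 h1
  have hg0 : g ≠ 0 := by rintro rfl; simp at hm
  have hh0 : h ≠ 0 := by rintro rfl; simp at hhm
  have hk0 : k ≠ 0 := by rintro rfl; simp [hk] at hg0
  have hkd : k.natDegree = 0 := by
    have h1 := hdeg h (fun x hx => hx h (hE hhE)) hhm
    rw [hk, natDegree_mul hh0 hk0] at h1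
    omega
  rw [eq_C_of_natDegree_eq_zero hkd] at hk hk0
  set c := k.coeff 0
  have hc0 : c ≠ 0 := fun h0 => hk0 (by rw [h0, C_0])
  have hcpos : (0 : ℝ) < (c : ℝ) := by
    rw [hk, map_mul, aeval_C, mul_comm] at hm
    exact pos_of_mul_neg_left hm hhm.le
  refine ⟨c⁻¹, by push_cast; positivity, ?_⟩
  have : C c⁻¹ * g = h := by
    rw [hk, mul_left_comm, ← C_mul, inv_mul_cancel₀ hc0, C_1, mul_one]
  rw [this]
  exact hE hhE

theorem X_sub_C_dvd_of_aeval_eq_zero {t : F[X]} {a : F} (h : aeval (a : ℝ) t = 0) :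
    X - C a ∣ t := by
  rw [dvd_iff_isRoot]
  have h1 : aeval (algebraMap F ℝ a) t = 0 := h
  rw [aeval_algebraMap_apply] at h1
  simpa [coe_aeval_eq_eval] using h1

theorem exists_eq_C_mul_of_dvd {t g : F[X]} (hg : g ≠ 0) (h : g ∣ t)
    (hd : t.natDegree ≤ g.natDegree) : ∃ e : F, t = C e * g := by
  obtain ⟨k, rfl⟩ := h
  rcases eq_or_ne k 0 with rfl | hk
  · exact ⟨0, by simp⟩
  rw [natDegree_mul hg hk] at hd
  have := eq_C_of_natDegree_eq_zero (show k.natDegree = 0 by omega)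
  exact ⟨k.coeff 0, by rw [← this, mul_comm]⟩

theorem one_le_natDegree_of_sign_change {h : F[X]} {x m : ℝ} (hx : 0 ≤ aeval x h)
    (hm : aeval m h < 0) : 1 ≤ h.natDegree := by
  by_contra! hlt
  rw [eq_C_of_natDegree_eq_zero (show h.natDegree = 0 by omega), aeval_C] at hx hm
  exact absurd hx (not_le.2 hm)

theorem two_le_natDegree_of_sign_changes {h : F[X]} {x m y : ℝ} (hxm : x < m) (hmy : m < y)
    (hx : 0 ≤ aeval x h) (hm : aeval m h < 0) (hy : 0 ≤ aeval y h) : 2 ≤ h.natDegree := by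
  by_contra! hlt
  obtain ⟨u, v, rfl⟩ := exists_eq_X_add_C_of_natDegree_le_one (show h.natDegree ≤ 1 by omega)
  simp only [map_add, map_mul, aeval_C, aeval_X] at hx hm hy
  nlinarith [mul_nonneg hx (sub_pos.2 hmy).le, mul_nonneg hy (sub_pos.2 hxm).le]

open Bornology in
/-- If the preordering of `S` contains the natural generators, then `S` contains them up to
scaling. -/
theorem containsUpToScaling_of_subset {S : Set F[X]} (hcl : IsClosed (basicClosed S))
    (hub : ¬ IsBounded (basicClosed S))
    (hN : naturalGenerators F (basicClosed S) ⊆ preordering S) :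
    ContainsUpToScaling (insert 1 S) (naturalGenerators F (basicClosed S)) := by
  intro g hg
  have hgT := hN hg
  have hgP := naturalGenerators_subset_posOn hg
  set K := basicClosed S
  have hzero : ∀ {z : ℝ}, z ∈ K → aeval z g = 0 → ∀ t ∈ posOn F K, g - t ∈ posOn F K →
      aeval z t = 0 := fun {z} hz hz0 t ht htg => by
    have h1 := ht z hz
    have h2 := htg z hz
    rw [map_sub, hz0] at h2
    linarith
  suffices h : (K = Set.univ ∧ g = 1) ∨ ∃ c : F, (0 : ℝ) < (c : ℝ) ∧ C c * g ∈ S by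
    rcases h with ⟨-, rfl⟩ | ⟨c, hc, h⟩
    · exact ⟨1, by simp, by simp⟩
    · exact ⟨c, hc, Or.inr h⟩
  rcases hg with ((⟨hu, rfl⟩ | ⟨a, ha, hI, rfl⟩) | ⟨a, ha, hI, rfl⟩) | ⟨a, b, ha, hb, hab, hI, rfl⟩
  · exact Or.inl ⟨hu, rfl⟩
  · have haK := mem_of_mem_frontier hcl ha
    refine Or.inr (exists_scaling_mem hgT (m := a - 1) ?_ (fun t ht htg => ?_) fun h hh hm => ?_)
    · simp only [map_sub, aeval_X, aeval_C]
      change (a : ℝ) - 1 - a < 0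
      linarith
    · refine exists_eq_C_mul_of_dvd (X_sub_C_ne_zero a) (X_sub_C_dvd_of_aeval_eq_zero
        (hzero haK ?_ t ht htg)) (natDegree_le_of_le_on_unbounded hub ht htg)
      simp only [map_sub, aeval_X, aeval_C]
      exact sub_self _
    · rw [natDegree_X_sub_C]
      exact one_le_natDegree_of_sign_change (hh a haK) hm
  · have haK := mem_of_mem_frontier hcl ha
    have hne : C a - X ≠ 0 := by rw [← neg_sub]; exact neg_ne_zero.2 (X_sub_C_ne_zero a)
    refine Or.inr (exists_scaling_mem hgT (m := a + 1) ?_ (fun t ht htg => ?_) fun h hh hm => ?_)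
    · simp only [map_sub, aeval_X, aeval_C]
      change (a : ℝ) - (a + 1) < 0
      linarith
    · refine exists_eq_C_mul_of_dvd hne ?_ (natDegree_le_of_le_on_unbounded hub ht htg)
      rw [← neg_sub, neg_dvd]
      refine X_sub_C_dvd_of_aeval_eq_zero (hzero haK ?_ t ht htg)
      simp only [map_sub, aeval_X, aeval_C]
      exact sub_self _
    · rw [← neg_sub, natDegree_neg, natDegree_X_sub_C]
      exact one_le_natDegree_of_sign_change (hh a haK) hm
  · have haK := mem_of_mem_frontier hcl ha
    have hbK := mem_of_mem_frontier hcl hb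
    refine Or.inr (exists_scaling_mem hgT (m := (a + b) / 2) ?_ (fun t ht htg => ?_)
      fun h hh hm => ?_)
    · simp only [map_mul, map_sub, aeval_X, aeval_C]
      change ((a + b : ℝ) / 2 - a) * ((a + b : ℝ) / 2 - b) < 0
      exact mul_neg_of_pos_of_neg (by linarith) (by linarith)
    · refine exists_eq_C_mul_of_dvd (mul_ne_zero (X_sub_C_ne_zero a) (X_sub_C_ne_zero b)) ?_
        (natDegree_le_of_le_on_unbounded hub ht htg)
      refine (isCoprime_X_sub_C_of_isUnit_sub (isUnit_iff_ne_zero.2 (sub_ne_zero.2 ?_))).mul_dvd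
        (X_sub_C_dvd_of_aeval_eq_zero (hzero haK ?_ t ht htg))
        (X_sub_C_dvd_of_aeval_eq_zero (hzero hbK ?_ t ht htg))
      · rintro rfl; exact lt_irrefl _ hab
      · simp only [map_mul, map_sub, aeval_X, aeval_C]
        exact mul_eq_zero_of_left (sub_self _) _
      · simp only [map_mul, map_sub, aeval_X, aeval_C]
        exact mul_eq_zero_of_right _ (sub_self _)
    · rw [natDegree_mul (X_sub_C_ne_zero a) (X_sub_C_ne_zero b), natDegree_X_sub_C,
        natDegree_X_sub_C]
      exact two_le_natDegree_of_sign_changes (by linarith) (by linarith) (hh a haK) hm (hh b hbK)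

open Bornology in
/-- A term `a * q ^ 2 * g` with `g` of degree at most two has degree greater than the number of
its zeros, once that number is at least three. -/
theorem notMem_quadraticModule (hub : ¬ IsBounded K) {f : F[X]} (hf0 : f ≠ 0) (Z : Finset ℝ)
    (hZK : ∀ z ∈ Z, z ∈ K) (hZf : ∀ z ∈ Z, aeval z f = 0) (hZ3 : 3 ≤ Z.card)
    (hdeg : f.natDegree ≤ Z.card) : f ∉ quadraticModule (naturalGenerators F K) := by
  intro hf
  obtain ⟨_, ⟨a, q, g, ha, hg, rfl⟩, ht0, hrest⟩ :=
    exists_term_of_mem_closure (P := fun p => p ≠ 0) (by simp)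
      (fun x y hxy => by
        by_contra! hcon
        exact hxy (by rw [hcon.1, hcon.2, add_zero])) hf hf0
  have ht : C a * q ^ 2 * g ∈ posOn F K :=
    quadraticModule_terms_subset_posOn ⟨a, q, g, ha, hg, rfl⟩
  have hr := closure_subset_posOn quadraticModule_terms_subset_posOn hrest
  have hd := natDegree_le_of_le_on_unbounded hub ht hr
  have ha0 : a ≠ 0 := by rintro rfl; simp at ht0
  have hq0 : q ≠ 0 := by rintro rfl; simp at ht0
  have hg0 : g ≠ 0 := by rintro rfl; simp at ht0
  have hgd : g.natDegree ≤ 2 := by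
    rcases hg with rfl | hg
    · simp
    · exact natDegree_naturalGenerators_le hg
  have hqg : (q * g).map F.subtype ≠ 0 := by
    rw [Polynomial.map_ne_zero_iff F.subtype.injective]
    exact mul_ne_zero hq0 hg0
  -- The degree `2 * deg q + deg g` of the summand is at most `#Z ≤ deg q + deg g`, so `q` is
  -- constant and `#Z ≤ deg g ≤ 2`.
  have hcard : Z.card ≤ ((q * g).map F.subtype).natDegree := by
    refine card_le_degree_of_subset_roots fun z hz => ?_
    have hz : z ∈ Z := hz
    have h1 := ht z (hZK z hz)
    have h2 := hr z (hZK z hz)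
    rw [map_sub, hZf z hz] at h2
    have h3 : aeval z (C a * q ^ 2 * g) = 0 := by linarith
    rw [map_mul, map_mul, map_pow, aeval_C] at h3
    have ha0' : algebraMap F ℝ a ≠ 0 := fun h => ha0 (by simpa using h)
    have h4 : aeval z q * aeval z g = 0 := by
      rcases mul_eq_zero.1 h3 with h | h
      · rw [pow_eq_zero_iff two_ne_zero |>.1 ((mul_eq_zero.1 h).resolve_left ha0'), zero_mul]
      · rw [h, mul_zero]
    refine (mem_roots hqg).2 ?_
    rw [IsRoot.def, eval_map, ← map_mul] at *
    exact h4
  rw [natDegree_map, natDegree_mul hq0 hg0] at hcard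
  rw [natDegree_mul (mul_ne_zero (C_ne_zero.2 ha0) (pow_ne_zero 2 hq0)) hg0,
    natDegree_C_mul ha0, natDegree_pow] at hd
  omega

/-- The generator `l` belongs to a gap of `K` (bounded or not) with right end `b`. -/
def EndsAt (K : Set ℝ) (l : F[X]) (b : F) : Prop :=
  (b : ℝ) ∈ K ∧ ((Set.Iio (b : ℝ) ∩ K = ∅ ∧ l = X - C b) ∨
    ∃ a : F, (a : ℝ) ∈ K ∧ (a : ℝ) < b ∧ Set.Ioo (a : ℝ) b ∩ K = ∅ ∧
      l = (X - C a) * (X - C b))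

/-- The generator `r` belongs to a gap of `K` (bounded or not) with left end `c`. -/
def StartsAt (K : Set ℝ) (r : F[X]) (c : F) : Prop :=
  (c : ℝ) ∈ K ∧ ((Set.Ioi (c : ℝ) ∩ K = ∅ ∧ r = C c - X) ∨
    ∃ d : F, (d : ℝ) ∈ K ∧ (c : ℝ) < d ∧ Set.Ioo (c : ℝ) d ∩ K = ∅ ∧
      r = (X - C c) * (X - C d))

/-- The gap of `l` lies to the left of the gap of `r`. -/
def IsBefore (K : Set ℝ) (l r : F[X]) : Prop :=
  ∃ b c : F, EndsAt K l b ∧ StartsAt K r c ∧ (b : ℝ) ≤ c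

theorem isBefore_or_isBefore (hcl : IsClosed K) {l r : F[X]} (hl : l ∈ naturalGenerators F K)
    (hr : r ∈ naturalGenerators F K) (hne : l ≠ r) : IsBefore K l r ∨ IsBefore K r l := by
  have huniv : ∀ {x : ℝ}, x ∈ frontier K → K ≠ Set.univ := by
    rintro x hx rfl
    simp at hx
  have hout : ∀ {s : Set ℝ}, s ∩ K = ∅ → ∀ {x}, x ∈ K → x ∉ s := fun h x hx hs =>
    Set.eq_empty_iff_forall_notMem.1 h x ⟨hs, hx⟩
  have hmem : ∀ {x : ℝ}, x ∈ frontier K → x ∈ K := fun h => mem_of_mem_frontier hcl h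
  rcases hl with ((⟨hu, rfl⟩ | ⟨a, ha, hI, rfl⟩) | ⟨a, ha, hI, rfl⟩) |
      ⟨a, b, ha, hb, hab, hI, rfl⟩ <;>
    rcases hr with ((⟨hu', rfl⟩ | ⟨a', ha', hI', rfl⟩) | ⟨a', ha', hI', rfl⟩) |
      ⟨a', b', ha', hb', hab', hI', rfl⟩
  · exact absurd rfl hne
  · exact absurd hu (huniv ha')
  · exact absurd hu (huniv ha')
  · exact absurd hu (huniv ha')
  · exact absurd hu' (huniv ha)
  · have h1 : (a : ℝ) ≤ a' := not_lt.1 (hout hI (hmem ha'))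
    have h2 : (a' : ℝ) ≤ a := not_lt.1 (hout hI' (hmem ha))
    exact absurd (by rw [Subtype.ext (le_antisymm h1 h2)]) hne
  · exact Or.inl ⟨a, a', ⟨hmem ha, Or.inl ⟨hI, rfl⟩⟩, ⟨hmem ha', Or.inl ⟨hI', rfl⟩⟩,
      not_lt.1 (hout hI (hmem ha'))⟩
  · exact Or.inl ⟨a, a', ⟨hmem ha, Or.inl ⟨hI, rfl⟩⟩,
      ⟨hmem ha', Or.inr ⟨b', hmem hb', hab', hI', rfl⟩⟩, not_lt.1 (hout hI (hmem ha'))⟩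
  · exact absurd hu' (huniv ha)
  · exact Or.inr ⟨a', a, ⟨hmem ha', Or.inl ⟨hI', rfl⟩⟩, ⟨hmem ha, Or.inl ⟨hI, rfl⟩⟩,
      not_lt.1 (hout hI' (hmem ha))⟩
  · have h1 : (a' : ℝ) ≤ a := not_lt.1 (hout hI (hmem ha'))
    have h2 : (a : ℝ) ≤ a' := not_lt.1 (hout hI' (hmem ha))
    exact absurd (by rw [Subtype.ext (le_antisymm h2 h1)]) hne
  · exact Or.inr ⟨b', a, ⟨hmem hb', Or.inr ⟨a', hmem ha', hab', hI', rfl⟩⟩,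
      ⟨hmem ha, Or.inl ⟨hI, rfl⟩⟩, not_lt.1 (hout hI (hmem hb'))⟩
  · exact absurd hu' (huniv ha)
  · exact Or.inr ⟨a', a, ⟨hmem ha', Or.inl ⟨hI', rfl⟩⟩,
      ⟨hmem ha, Or.inr ⟨b, hmem hb, hab, hI, rfl⟩⟩, not_lt.1 (hout hI' (hmem ha))⟩
  · exact Or.inl ⟨b, a', ⟨hmem hb, Or.inr ⟨a, hmem ha, hab, hI, rfl⟩⟩,
      ⟨hmem ha', Or.inl ⟨hI', rfl⟩⟩, not_lt.1 (hout hI' (hmem hb))⟩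
  · rcases lt_trichotomy (a : ℝ) a' with h | h | h
    · exact Or.inl ⟨b, a', ⟨hmem hb, Or.inr ⟨a, hmem ha, hab, hI, rfl⟩⟩,
        ⟨hmem ha', Or.inr ⟨b', hmem hb', hab', hI', rfl⟩⟩,
        not_lt.1 fun h4 => hout hI (hmem ha') ⟨h, h4⟩⟩
    · have h1 : (b : ℝ) ≤ b' := not_lt.1 fun h4 => hout hI (hmem hb') ⟨h ▸ hab', h4⟩
      have h2 : (b' : ℝ) ≤ b := not_lt.1 fun h4 => hout hI' (hmem hb) ⟨h ▸ hab, h4⟩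
      exact absurd (by rw [Subtype.ext h, Subtype.ext (le_antisymm h1 h2)]) hne
    · exact Or.inr ⟨b', a, ⟨hmem hb', Or.inr ⟨a', hmem ha', hab', hI', rfl⟩⟩,
        ⟨hmem ha, Or.inr ⟨b, hmem hb, hab, hI, rfl⟩⟩,
        not_lt.1 fun h4 => hout hI' (hmem ha) ⟨h, h4⟩⟩

theorem EndsAt.exists_neg {l : F[X]} {b : F} (h : EndsAt K l b) :
    ∃ x < (b : ℝ), Set.Ioo x (b : ℝ) ∩ K = ∅ ∧ ∃ y < (b : ℝ), aeval y l < 0 := by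
  obtain ⟨-, ⟨hI, rfl⟩ | ⟨a, -, hab, hI, rfl⟩⟩ := h
  · refine ⟨b - 1, by linarith, ?_, b - 1, by linarith, ?_⟩
    · exact Set.eq_empty_iff_forall_notMem.2 fun x hx =>
        Set.eq_empty_iff_forall_notMem.1 hI x ⟨hx.1.2, hx.2⟩
    · simp only [map_sub, aeval_X, aeval_C]
      change (b : ℝ) - 1 - b < 0
      linarith
  · refine ⟨a, hab, hI, (a + b) / 2, by linarith, ?_⟩
    simp only [map_mul, map_sub, aeval_X, aeval_C]
    change ((a + b : ℝ) / 2 - a) * ((a + b : ℝ) / 2 - b) < 0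
    exact mul_neg_of_pos_of_neg (by linarith) (by linarith)

theorem StartsAt.exists_gap {r : F[X]} {c : F} (h : StartsAt K r c) :
    ∃ x > (c : ℝ), Set.Ioo (c : ℝ) x ∩ K = ∅ := by
  obtain ⟨-, ⟨hI, rfl⟩ | ⟨d, -, hcd, hI, rfl⟩⟩ := h
  · exact ⟨c + 1, by linarith, Set.eq_empty_iff_forall_notMem.2 fun x hx =>
        Set.eq_empty_iff_forall_notMem.1 hI x ⟨hx.1.1, hx.2⟩⟩
  · exact ⟨d, hcd, hI⟩

theorem StartsAt.pos {r : F[X]} {c : F} (h : StartsAt K r c) {x : ℝ} (hx : x < c) :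
    0 < aeval x r := by
  obtain ⟨-, ⟨-, rfl⟩ | ⟨d, -, hcd, -, rfl⟩⟩ := h <;>
    simp only [map_mul, map_sub, aeval_X, aeval_C]
  · exact sub_pos.2 hx
  · change 0 < (x - (c : ℝ)) * (x - (d : ℝ))
    exact mul_pos_of_neg_of_neg (by linarith) (by linarith)

theorem StartsAt.lt_of_endsAt {g : F[X]} {c b : F} (hc : StartsAt K g c) (hb : EndsAt K g b) :
    (c : ℝ) < b := by
  by_contra! hle
  obtain ⟨-, -, -, y, hy, hneg⟩ := hb.exists_neg
  exact lt_asymm hneg (hc.pos (hy.trans_le hle))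

theorem hasIsolatedPoint_of_endsAt_of_startsAt {l r : F[X]} {b : F} (hl : EndsAt K l b)
    (hr : StartsAt K r b) : HasIsolatedPoint K := by
  obtain ⟨x, hx, hxI, -⟩ := hl.exists_neg
  obtain ⟨y, hy, hyI⟩ := hr.exists_gap
  refine ⟨b, Set.Ioo x y, isOpen_Ioo, Set.eq_singleton_iff_unique_mem.2
    ⟨⟨⟨hx, hy⟩, hl.1⟩, fun z hz => ?_⟩⟩
  rcases lt_trichotomy z b with h | h | h
  · exact absurd ⟨⟨hz.1.1, h⟩, hz.2⟩ (Set.eq_empty_iff_forall_notMem.1 hxI z)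
  · exact h
  · exact absurd ⟨⟨h, hz.1.2⟩, hz.2⟩ (Set.eq_empty_iff_forall_notMem.1 hyI z)

/-- An isolated point of `K` is the right end of one gap and the left end of another one. -/
theorem HasIsolatedPoint.exists_generators (hcl : IsClosed K) (hbd : frontier K ⊆ (F : Set ℝ))
    (h : HasIsolatedPoint K) : ∃ (b : F) (l r : F[X]), l ∈ naturalGenerators F K ∧
      r ∈ naturalGenerators F K ∧ EndsAt K l b ∧ StartsAt K r b := by
  obtain ⟨x, U, hU, hUK⟩ := h
  have hxU : x ∈ U ∩ K := hUK ▸ rfl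
  obtain ⟨e, he, hball⟩ := Metric.isOpen_iff.1 hU x hxU.1
  have hnear : ∀ y ∈ K, x - e < y → y < x + e → y = x := fun y hy h1 h2 => by
    have : y ∈ U ∩ K := ⟨hball (by rw [Real.ball_eq_Ioo]; exact ⟨h1, h2⟩), hy⟩
    rwa [hUK] at this
  have hleft : Set.Ioo (x - e) x ∩ K = ∅ := Set.eq_empty_iff_forall_notMem.2 fun y hy =>
    hy.1.2.ne (hnear y hy.2 hy.1.1 (by linarith [hy.1.2]))
  have hright : Set.Ioo x (x + e) ∩ K = ∅ := Set.eq_empty_iff_forall_notMem.2 fun y hy =>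
    hy.1.1.ne' (hnear y hy.2 (by linarith [hy.1.1]) hy.1.2)
  have hfr := mem_frontier_of_Ioo_left hxU.2 (show x - e < x by linarith) hleft
  obtain ⟨b, rfl⟩ : ∃ b : F, (b : ℝ) = x := ⟨⟨x, hbd hfr⟩, rfl⟩
  have hL : ∃ l ∈ naturalGenerators F K, EndsAt K l b := by
    rcases (K ∩ Set.Iic ((b : ℝ) - e)).eq_empty_or_nonempty with h1 | h1
    · have hI : Set.Iio (b : ℝ) ∩ K = ∅ := Set.eq_empty_iff_forall_notMem.2 fun y hy => by
        rcases le_or_gt y (b - e) with h2 | h2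
        · exact Set.eq_empty_iff_forall_notMem.1 h1 y ⟨hy.2, h2⟩
        · exact Set.eq_empty_iff_forall_notMem.1 hleft y ⟨⟨h2, hy.1⟩, hy.2⟩
      exact ⟨_, Or.inl (Or.inl (Or.inr ⟨b, hfr, hI, rfl⟩)), hxU.2, Or.inl ⟨hI, rfl⟩⟩
    · obtain ⟨a, b', hae, hbb, ha, hb', hI, hN⟩ := exists_gap_generator hcl hbd
        (show (b : ℝ) - e < b by linarith) hleft h1 ⟨b, hxU.2, le_refl (b : ℝ)⟩
      have hle : (b' : ℝ) ≤ b := not_lt.1 fun h2 =>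
        Set.eq_empty_iff_forall_notMem.1 hI b ⟨⟨by linarith, h2⟩, hxU.2⟩
      obtain rfl : b' = b := Subtype.ext (le_antisymm hle hbb)
      exact ⟨_, hN, hxU.2, Or.inr ⟨a, ha, by linarith, hI, rfl⟩⟩
  have hR : ∃ r ∈ naturalGenerators F K, StartsAt K r b := by
    rcases (K ∩ Set.Ici ((b : ℝ) + e)).eq_empty_or_nonempty with h1 | h1
    · have hI : Set.Ioi (b : ℝ) ∩ K = ∅ := Set.eq_empty_iff_forall_notMem.2 fun y hy => by
        rcases le_or_gt (b + e) y with h2 | h2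
        · exact Set.eq_empty_iff_forall_notMem.1 h1 y ⟨hy.2, h2⟩
        · exact Set.eq_empty_iff_forall_notMem.1 hright y ⟨⟨hy.1, h2⟩, hy.2⟩
      exact ⟨_, Or.inl (Or.inr ⟨b, hfr, hI, rfl⟩), hxU.2, Or.inl ⟨hI, rfl⟩⟩
    · obtain ⟨b', d, hbb, hde, hb', hd, hI, hN⟩ := exists_gap_generator hcl hbd
        (show (b : ℝ) < b + e by linarith) hright ⟨b, hxU.2, le_refl (b : ℝ)⟩ h1
      have hle : (b : ℝ) ≤ b' := not_lt.1 fun h2 =>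
        Set.eq_empty_iff_forall_notMem.1 hI b ⟨⟨h2, by linarith⟩, hxU.2⟩
      obtain rfl : b' = b := Subtype.ext (le_antisymm hbb hle)
      exact ⟨_, hN, hxU.2, Or.inr ⟨d, hd, by linarith, hI, rfl⟩⟩
  obtain ⟨l, hlN, hl⟩ := hL
  obtain ⟨r, hrN, hr⟩ := hR
  exact ⟨b, l, r, hlN, hrN, hl, hr⟩

open Bornology in
theorem not_lower_and_upper_bound (hub : ¬ IsBounded K) {b c : ℝ} (hb : Set.Iio b ∩ K = ∅)
    (hc : Set.Ioi c ∩ K = ∅) : False :=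
  hub ((Metric.isBounded_Icc b c).subset fun x hx =>
    ⟨not_lt.1 fun h => Set.eq_empty_iff_forall_notMem.1 hb x ⟨h, hx⟩,
      not_lt.1 fun h => Set.eq_empty_iff_forall_notMem.1 hc x ⟨h, hx⟩⟩)

open Bornology in
/-- The product of the generators of the two gaps at an isolated point `b` is a combination of the
two with nonnegative multiples of squares as coefficients. With outer ends `a < b < d` and
`b = t * d + (1 - t) * a` it is `t * (X - d) ^ 2 * l + (1 - t) * (X - a) ^ 2 * r`; the other two
cases are similar, with one outer end at infinity. -/
theorem mul_mem_quadraticModule_of_isolated (hub : ¬ IsBounded K) {l r : F[X]} {b : F}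
    (hlN : l ∈ naturalGenerators F K) (hrN : r ∈ naturalGenerators F K) (hl : EndsAt K l b)
    (hr : StartsAt K r b) : l * r ∈ quadraticModule (naturalGenerators F K) := by
  have key : ∀ (u v : F) (p q : F[X]), (0 : ℝ) ≤ u → (0 : ℝ) ≤ v →
      l * r = C u * p ^ 2 * l + C v * q ^ 2 * r →
      l * r ∈ quadraticModule (naturalGenerators F K) := fun u v p q hu hv h => by
    rw [h]
    exact add_mem (S := AddSubmonoid F[X]) (mul_mem_quadraticModule hu p (Or.inr hlN))
      (mul_mem_quadraticModule hv q (Or.inr hrN))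
  obtain ⟨-, ⟨hI, rfl⟩ | ⟨a, -, hab, -, rfl⟩⟩ := hl <;>
    obtain ⟨-, ⟨hJ, rfl⟩ | ⟨d, -, hbd, -, rfl⟩⟩ := hr
  · exact (not_lower_and_upper_bound hub hI hJ).elim
  · refine key 1 (d - b) (X - C d) 1 (by simp) (by push_cast; linarith) ?_
    rw [C_1, C_sub]; ring
  · refine key (b - a) 1 1 (X - C a) (by push_cast; linarith) (by simp) ?_
    rw [C_1, C_sub]; ring
  · have hda : d - a ≠ 0 := fun h0 => by
      have := congrArg (fun z : F => (z : ℝ)) h0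
      push_cast at this
      linarith
    have hu : (0 : ℝ) < d - a := by linarith
    obtain ⟨t, ht⟩ : ∃ t : F, t = (b - a) / (d - a) := ⟨_, rfl⟩
    have htb : b = t * d + (1 - t) * a := by rw [ht]; field_simp; ring
    refine key t (1 - t) (X - C d) (X - C a) ?_ ?_ ?_
    · rw [ht]; push_cast; exact div_nonneg (by linarith) hu.le
    · rw [ht]; push_cast; rw [sub_nonneg, div_le_one hu]; linarith
    · have hCb : (C b : F[X]) = C t * C d + (1 - C t) * C a := by
        conv_lhs => rw [htb]
        simp
      rw [C_sub, C_1]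
      linear_combination (-(X - C a) * (X - C b) * (X - C d)) * hCb

open Bornology in
/-- The generators of two gaps without a common end have at least three zeros together, since the
gaps are not both unbounded. -/
theorem mul_notMem_quadraticModule (hub : ¬ IsBounded K) {l r : F[X]} {b c : F}
    (hl : EndsAt K l b) (hr : StartsAt K r c) (hbc : (b : ℝ) < c) :
    l * r ∉ quadraticModule (naturalGenerators F K) := by
  have hev : ∀ (z : ℝ) (a : F), aeval z (X - C a) = z - a := fun z a => by
    rw [map_sub, aeval_X, aeval_C]; rfl
  obtain ⟨hbK, ⟨hI, rfl⟩ | ⟨a, haK, hab, -, rfl⟩⟩ := hl <;>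
    obtain ⟨hcK, ⟨hJ, rfl⟩ | ⟨d, hdK, hcd, -, rfl⟩⟩ := hr
  · exact (not_lower_and_upper_bound hub hI hJ).elim
  · have hcard : ({(b : ℝ), (c : ℝ), (d : ℝ)} : Finset ℝ).card = 3 :=
      Finset.card_eq_three.2 ⟨_, _, _, hbc.ne, (hbc.trans hcd).ne, hcd.ne, rfl⟩
    refine notMem_quadraticModule hub ?_ {(b : ℝ), (c : ℝ), (d : ℝ)} ?_ ?_ hcard.ge ?_
    · exact mul_ne_zero (X_sub_C_ne_zero b) (mul_ne_zero (X_sub_C_ne_zero c) (X_sub_C_ne_zero d))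
    · simp [hbK, hcK, hdK]
    · simp [hev, -map_sub]
    · rw [hcard]; compute_degree!
  · have hcard : ({(a : ℝ), (b : ℝ), (c : ℝ)} : Finset ℝ).card = 3 :=
      Finset.card_eq_three.2 ⟨_, _, _, hab.ne, (hab.trans hbc).ne, hbc.ne, rfl⟩
    rw [← neg_sub X (C c)]
    refine notMem_quadraticModule hub ?_ {(a : ℝ), (b : ℝ), (c : ℝ)} ?_ ?_ hcard.ge ?_
    · exact mul_ne_zero (mul_ne_zero (X_sub_C_ne_zero a) (X_sub_C_ne_zero b))
        (neg_ne_zero.2 (X_sub_C_ne_zero c))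
    · simp [hbK, hcK, haK]
    · simp [hev, -map_sub, -neg_sub]
    · rw [hcard]; compute_degree!
  · have hcard : ({(a : ℝ), (b : ℝ), (c : ℝ), (d : ℝ)} : Finset ℝ).card = 4 := by
      rw [Finset.card_insert_of_notMem, Finset.card_eq_three.2
        ⟨_, _, _, hbc.ne, (hbc.trans hcd).ne, hcd.ne, rfl⟩]
      simp only [Finset.mem_insert, Finset.mem_singleton, not_or]
      exact ⟨hab.ne, (hab.trans hbc).ne, (hab.trans (hbc.trans hcd)).ne⟩
    refine notMem_quadraticModule hub ?_ {(a : ℝ), (b : ℝ), (c : ℝ), (d : ℝ)} ?_ ?_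
      (by rw [hcard]; norm_num) ?_
    · exact mul_ne_zero (mul_ne_zero (X_sub_C_ne_zero a) (X_sub_C_ne_zero b))
        (mul_ne_zero (X_sub_C_ne_zero c) (X_sub_C_ne_zero d))
    · simp [haK, hbK, hcK, hdK]
    · simp [hev, -map_sub]
    · rw [hcard]; compute_degree!

theorem mul_mem_posOn {f g : F[X]} (hf : f ∈ posOn F K) (hg : g ∈ posOn F K) :
    f * g ∈ posOn F K := fun x hx => by
  rw [map_mul]; exact mul_nonneg (hf x hx) (hg x hx)

/-- Of three gaps in a row, the outer two have no common end. -/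
theorem IsBefore.exists_lt {l m r : F[X]} (h₁ : IsBefore K l m) (h₂ : IsBefore K m r) :
    ∃ b c : F, EndsAt K l b ∧ StartsAt K r c ∧ (b : ℝ) < c := by
  obtain ⟨b, c, hb, hc, hbc⟩ := h₁
  obtain ⟨b', c', hb', hc', hbc'⟩ := h₂
  exact ⟨b, c', hb, hc', by linarith [hc.lt_of_endsAt hb']⟩

theorem exists_separated_of_three (hcl : IsClosed K) {u v w : F[X]}
    (hu : u ∈ naturalGenerators F K) (hv : v ∈ naturalGenerators F K)
    (hw : w ∈ naturalGenerators F K) (huv : u ≠ v) (huw : u ≠ w) (hvw : v ≠ w) :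
    ∃ l ∈ naturalGenerators F K, ∃ r ∈ naturalGenerators F K, ∃ b c : F,
      EndsAt K l b ∧ StartsAt K r c ∧ (b : ℝ) < c := by
  rcases isBefore_or_isBefore hcl hu hv huv with h₁ | h₁ <;>
    rcases isBefore_or_isBefore hcl hv hw hvw with h₂ | h₂ <;>
    rcases isBefore_or_isBefore hcl hu hw huw with h₃ | h₃
  · exact ⟨u, hu, w, hw, h₁.exists_lt h₂⟩
  · exact ⟨u, hu, w, hw, h₁.exists_lt h₂⟩
  · exact ⟨u, hu, v, hv, h₃.exists_lt h₂⟩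
  · exact ⟨w, hw, v, hv, h₃.exists_lt h₁⟩
  · exact ⟨v, hv, w, hw, h₁.exists_lt h₃⟩
  · exact ⟨v, hv, u, hu, h₂.exists_lt h₃⟩
  · exact ⟨w, hw, u, hu, h₂.exists_lt h₁⟩
  · exact ⟨w, hw, u, hu, h₂.exists_lt h₁⟩

/-- Unless there is at most one gap, or there are two gaps that meet in an isolated point, two
gaps have no common end. -/
theorem exists_separated (hcl : IsClosed K) (h1 : ¬ (naturalGenerators F K).encard ≤ 1)
    (h2 : ¬ ((naturalGenerators F K).encard = 2 ∧ HasIsolatedPoint K)) :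
    ∃ l ∈ naturalGenerators F K, ∃ r ∈ naturalGenerators F K, ∃ b c : F,
      EndsAt K l b ∧ StartsAt K r c ∧ (b : ℝ) < c := by
  obtain ⟨u, v, hu, hv, huv⟩ := Set.one_lt_encard_iff.1 (not_le.1 h1)
  by_cases h3 : naturalGenerators F K = {u, v}
  · have hiso : ¬ HasIsolatedPoint K := fun h => h2 ⟨by rw [h3, Set.encard_pair huv], h⟩
    rcases isBefore_or_isBefore hcl hu hv huv with ⟨b, c, hb, hc, hbc⟩ | ⟨b, c, hb, hc, hbc⟩
    · refine ⟨u, hu, v, hv, b, c, hb, hc, hbc.lt_of_ne fun h => hiso ?_⟩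
      exact hasIsolatedPoint_of_endsAt_of_startsAt hb (Subtype.ext h ▸ hc)
    · refine ⟨v, hv, u, hu, b, c, hb, hc, hbc.lt_of_ne fun h => hiso ?_⟩
      exact hasIsolatedPoint_of_endsAt_of_startsAt hb (Subtype.ext h ▸ hc)
  · obtain ⟨w, hw, hwuv⟩ : ∃ w ∈ naturalGenerators F K, w ∉ ({u, v} : Set F[X]) := by
      by_contra! hcon
      exact h3 (Set.Subset.antisymm hcon (Set.pair_subset hu hv))
    simp only [Set.mem_insert_iff, Set.mem_singleton_iff, not_or] at hwuv
    exact exists_separated_of_three hcl hu hv hw huv (Ne.symm hwuv.1) (Ne.symm hwuv.2)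

open Bornology in
theorem mul_mem_quadraticModule_naturalGenerators (hcl : IsClosed K)
    (hbd : frontier K ⊆ (F : Set ℝ)) (hub : ¬ IsBounded K)
    (h : (naturalGenerators F K).encard ≤ 1 ∨
      ((naturalGenerators F K).encard = 2 ∧ HasIsolatedPoint K)) :
    ∀ g ∈ naturalGenerators F K, ∀ g' ∈ naturalGenerators F K,
      g * g' ∈ quadraticModule (naturalGenerators F K) := by
  have hself : ∀ g : F[X], g * g ∈ quadraticModule (naturalGenerators F K) := fun g => by
    have := mul_mem_quadraticModule (N := naturalGenerators F K) (a := 1) (by simp) g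
      (Set.mem_insert 1 _)
    rwa [C_1, one_mul, mul_one, pow_two] at this
  rcases h with h | ⟨h, hiso⟩
  · intro g hg g' hg'
    rw [Set.encard_le_one_iff.1 h g g' hg hg']
    exact hself g'
  · obtain ⟨b, l, r, hlN, hrN, hl, hr⟩ := hiso.exists_generators hcl hbd
    have hlr : l ≠ r := by
      rintro rfl
      exact lt_irrefl _ (hr.lt_of_endsAt hl)
    have hNeq : naturalGenerators F K = {l, r} := by
      have hfin : ({l, r} : Set F[X]).Finite := Set.toFinite _
      refine (hfin.eq_of_subset_of_encard_le (Set.pair_subset hlN hrN) ?_).symm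
      rw [h, Set.encard_pair hlr]
    have hlrM := mul_mem_quadraticModule_of_isolated hub hlN hrN hl hr
    intro g hg g' hg'
    rw [hNeq] at hg hg'
    rcases hg with rfl | rfl <;> rcases hg' with rfl | rfl
    · exact hself _
    · exact hlrM
    · rw [mul_comm]; exact hlrM
    · exact hself _

end Gaps

end SaturationLine

theorem theorem4p2 (F : Subfield ℝ) (S : Finset F[X]) (K : Set ℝ)
    (hK : K = SaturationLine.basicClosed (S : Set F[X]))
    (hbd : frontier K ⊆ (F : Set ℝ))
    (hnc : ¬ IsCompact K) :
    (SaturationLine.posOn F K = SaturationLine.preordering (S : Set F[X]) ↔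
      SaturationLine.ContainsUpToScaling (insert 1 (S : Set F[X]))
        (SaturationLine.naturalGenerators F K)) ∧
    (SaturationLine.posOn F K =
        SaturationLine.quadraticModule (SaturationLine.naturalGenerators F K) ↔
      (SaturationLine.naturalGenerators F K).encard ≤ 1 ∨
      ((SaturationLine.naturalGenerators F K).encard = 2 ∧
        SaturationLine.HasIsolatedPoint K)) := by
  open SaturationLine in
  have hcl : IsClosed K := hK ▸ isClosed_basicClosed _
  have hub : ¬ Bornology.IsBounded K := fun h => hnc (Metric.isCompact_of_isClosed_isBounded hcl h)
  have hne : K.Nonempty := Set.nonempty_iff_ne_empty.2 fun h => hnc (h ▸ isCompact_empty)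
  refine ⟨⟨fun h => ?_, fun h => ?_⟩, fun h => ?_, fun h => ?_⟩
  · subst hK
    exact containsUpToScaling_of_subset hcl hub (naturalGenerators_subset_posOn.trans h.subset)
  · refine Set.Subset.antisymm ?_ fun p hp => ?_
    · refine posOn_subset (T := preorderingSubsemiring (S : Set F[X])) hcl hbd hne
        (fun a ha => C_mem_preordering _ ha) (sq_mem_preordering _) fun g hg => ?_
      obtain ⟨c, hc, hcg⟩ := h g hg
      have hc0 : c ≠ 0 := by rintro rfl; simp at hc
      have hmem : C c * g ∈ preorderingSubsemiring (S : Set F[X]) := by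
        rcases hcg with h1 | h1
        · rw [h1]; exact Subsemiring.one_mem _
        · exact subset_preordering _ h1
      have h2 := Subsemiring.mul_mem _
        (C_mem_preordering (S : Set F[X]) (a := c⁻¹) (by push_cast; positivity)) hmem
      rwa [← mul_assoc, ← C_mul, inv_mul_cancel₀ hc0, C_1, one_mul] at h2
    · rw [hK]
      exact closure_subset_posOn preordering_terms_subset_posOn hp
  · by_contra! hcon
    obtain ⟨l, hl, r, hr, b, c, hb, hc, hbc⟩ := exists_separated hcl (not_le.2 hcon.1)
      fun h2 => hcon.2 h2.1 h2.2
    refine mul_notMem_quadraticModule hub hb hc hbc ?_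
    rw [← h]
    exact mul_mem_posOn (naturalGenerators_subset_posOn hl) (naturalGenerators_subset_posOn hr)
  · refine Set.Subset.antisymm ?_ fun p hp =>
      closure_subset_posOn quadraticModule_terms_subset_posOn hp
    refine posOn_subset (T := quadraticModuleSubsemiring _
      (mul_mem_quadraticModule_naturalGenerators hcl hbd hub h)) hcl hbd hne
      (fun a ha => ?_) (fun q => ?_) fun g hg => ?_
    · change _ ∈ quadraticModule _
      simpa using mul_mem_quadraticModule (N := naturalGenerators F K) ha 1 (Set.mem_insert 1 _)
    · change _ ∈ quadraticModule _
      simpa using mul_mem_quadraticModule (N := naturalGenerators F K) (a := 1) (by simp) q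
        (Set.mem_insert 1 _)
    · change _ ∈ quadraticModule _
      simpa using mul_mem_quadraticModule (N := naturalGenerators F K) (a := 1) (by simp) 1
        (Set.mem_insert_of_mem 1 hg)
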